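/- **Setting.** Let $(\Omega,\mathcal F_\infty,(\mathcal F_t)_{t\ge 0},P)$ be a filtered probability space satisfying the usual assumptions, with $\mathcal F_\infty=\sigma(\bigcup_t\mathcal F_t)$ and $\mathcal F_0$ generated by the $P$-null sets. Stopping times take values in $[0,\infty]$. Write $L^\infty(\mathcal F_\tau)=L^\infty(\Omega,\mathcal F_\tau,P)$. A *TCPP* is a family of maps $\Pi_{\sigma,\tau}:L^\infty(\mathcal F_\tau)\to L^\infty(\mathcal F_\sigma)$, indexed by the stopping times $\sigma\le\tau$, such that each $\Pi_{\sigma,\tau}$ is monotone, convex (for scalars $\lambda\in[0,1]$), normalized ($\Pi_{\sigma,\tau}(0)=0$) and translation invariant ($\Pi_{\sigma,\tau}(X+Z)=\Pi_{\sigma,\tau}(X)+Z$ for $Z\in L^\infty(\mathcal F_\sigma)$), which is continuous from below (if $X_n\uparrow X$ a.s. in $L^\infty(\mathcal F_\tau)$, then $\Pi_{\sigma,\tau}(X_n)\uparrow\Pi_{\sigma,\tau}(X)$ a.s.) and time-consistent ($\Pi_{\nu,\sigma}(\Pi_{\sigma,\tau}(X))=\Pi_{\nu,\tau}(X)$ for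 $\nu\le\sigma\le\tau$ and $X\in L^\infty(\mathcal F_\tau)$). It has *No Free Lunch* if $\overline{\mathcal C}\cap L^\infty_+(\mathcal F_\infty)=\{0\}$, where $\overline{\mathcal C}$ is the $\sigma(L^\infty(P),L^1(P))$-closure of $\mathcal C=\{\lambda X:\lambda\ge0,\ X\in L^\infty(\mathcal F_\infty),\ \Pi_{0,\infty}(X)\le0\}$. For a probability measure $Q\ll P$ the *minimal penalty* is $$\alpha^m_{\sigma,\tau}(Q)=Q\text{-}\operatorname{ess\,sup}_{X\in L^\infty(\mathcal F_\tau)}\big(E_Q(X\mid\mathcal F_\sigma)-\Pi_{\sigma,\tau}(X)\big)\in[0,\infty].$$ Let $(S^k)_{0\le k\le d}$ be adapted, locally bounded real processes with $S^0\equiv1$. For a stopping time $\tau$, the variable $S^k_\tau$ is defined if $\lim_{t\to\infty}S^k_t$ exists a.s. on $\{\tau=\infty\}$; this limit is then its value there. The TCPP *extends the dynamics of $(S^k)$* if $\Pi_{\sigma,\tau}(nS^k_\tau)=nS^k_\sigma$ for all $k$, all $n\in\mathbb Z$ and all stopping times $\sigma\le\tau$ such that $S^k_\tau$ is defined and lies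 in $L^\infty(\mathcal F_\tau)$. A probability measure $Q$ on $\mathcal F_\infty$ with $Q\sim P$ is called here an *equivalent local martingale measure for $(S^k)$* if $E_Q(S^k_\tau\mid\mathcal F_\sigma)=S^k_\sigma$ a.s. for all $k$ and all stopping times $\sigma\le\tau$ such that $S^k_\tau$ is defined and lies in $L^\infty(\mathcal F_\tau)$; it is called a *local martingale measure between $\sigma_0$ and $\tau_0$* if this holds for all such $\sigma,\tau$ with $\sigma_0\le\sigma\le\tau\le\tau_0$. The set of equivalent local martingale measures is denoted $\mathcal M^e$. **Statement.** Let $(\Pi_{\sigma,\tau})$ be a TCPP with No Free Lunch. Then $(\Pi_{\sigma,\tau})$ extends the dynamics of $(S^k)_{0\le k\le d}$ if and only if it has a dual representation in terms of equivalent local martingale measures. Precisely, the extension property is equivalent to each of the following, where $$\Pi_{\sigma,\tau}(X)=\operatorname*{ess\,sup}_{Q\in\mathcal Q_{\sigma,\tau}}\big(E_Q(X\mid\mathcal F_\sigma)-\alpha^m_{\sigma,\tau}(Q)\big)\qquad\text{for all stopping times }\sigma\le\tau\text{ and all }X\in L^\infty(\mathcal F_\tau):\tag{$*$}$$ 1.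 there is a set $\mathcal Q\subseteq\mathcal M^e$ such that $(*)$ holds with $\mathcal Q_{\sigma,\tau}=\mathcal Q$ for all $\sigma\le\tau$; 2. $(*)$ holds with $\mathcal Q_{\sigma,\tau}=\{Q\in\mathcal M^e:\alpha^m_{0,\infty}(Q)<\infty\}$; 3. $(*)$ holds with $\mathcal Q_{\sigma,\tau}$ the set of the probability measures $Q\sim P$ with $Q|_{\mathcal F_\sigma}=P|_{\mathcal F_\sigma}$ and $E_Q(\alpha^m_{\sigma,\tau}(Q))<\infty$ that are local martingale measures between $\sigma$ and $\tau$. -/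

import Mathlib

open MeasureTheory ProbabilityTheory Filter Topology
open scoped ENNReal NNReal

noncomputable section

/-! ### Essential suprema of arbitrary families -/

/-- `Z` is an essential supremum under `μ` of the family `𝒮` of extended real functions: it is
measurable, it dominates every member almost surely, and it is almost surely below any other
measurable function that does. -/
structure IsEssSupOf {Ω : Type*} {m : MeasurableSpace Ω} (μ : Measure Ω)
    (𝒮 : Set (Ω → EReal)) (Z : Ω → EReal) : Prop where
  measurable : Measurable Z
  le : ∀ f ∈ 𝒮, f ≤ᵐ[μ] Z
  least : ∀ Z' : Ω → EReal, Measurable Z' → (∀ f ∈ 𝒮, f ≤ᵐ[μ] Z') → Z ≤ᵐ[μ] Z'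

theorem exists_isEssSupOf {Ω : Type*} {m : MeasurableSpace Ω} (μ : Measure Ω) [IsFiniteMeasure μ]
    (𝒮 : Set (Ω → EReal)) : ∃ Z, IsEssSupOf μ 𝒮 Z := by
  let φ : EReal → ℝ≥0∞ := fun x => (1 + EReal.exp x)⁻¹
  have hφa : StrictAnti φ := by
    intro x y hxy
    refine ENNReal.inv_lt_inv.2 (ENNReal.add_lt_add_left (by simp) (EReal.exp_strictMono hxy))
  have hφm : Measurable φ := hφa.antitone.measurable
  have hφ1 : ∀ x, φ x ≤ 1 := fun x => ENNReal.inv_le_one.2 le_self_add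
  let D : Set (Ω → EReal) := {Z | Measurable Z ∧ ∀ f ∈ 𝒮, f ≤ᵐ[μ] Z}
  let G : (Ω → EReal) → ℝ≥0∞ := fun Z => ∫⁻ ω, φ (Z ω) ∂μ
  have hD : (G '' D).Nonempty :=
    ⟨G fun _ => ⊤, Set.mem_image_of_mem G
      (show (fun _ => ⊤) ∈ D from ⟨measurable_const, fun f _ => ae_of_all _ fun ω => le_top⟩)⟩
  obtain ⟨u, -, hu, huD⟩ := exists_seq_tendsto_sSup hD (OrderTop.bddAbove _)
  choose Z hZD hZu using huD
  have hW : (fun ω => ⨅ n, Z n ω) ∈ D := by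
    refine ⟨Measurable.iInf fun n => (hZD n).1, fun f hf => ?_⟩
    filter_upwards [ae_all_iff.2 fun n => (hZD n).2 f hf] with ω hω
    exact le_iInf hω
  refine ⟨fun ω => ⨅ n, Z n ω, hW.1, hW.2, fun Z' hZ' hd => ?_⟩
  have hM : (fun ω => min (⨅ n, Z n ω) (Z' ω)) ∈ D := by
    refine ⟨hW.1.min hZ', fun f hf => ?_⟩
    filter_upwards [hW.2 f hf, hd f hf] with ω h1 h2
    exact le_min h1 h2
  have hs : sSup (G '' D) ≤ G (fun ω => ⨅ n, Z n ω) := by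
    refine le_of_tendsto hu (Eventually.of_forall fun n => ?_)
    rw [← hZu n]
    exact lintegral_mono fun ω => hφa.antitone (iInf_le _ n)
  have hle : G (fun ω => min (⨅ n, Z n ω) (Z' ω)) ≤ G (fun ω => ⨅ n, Z n ω) :=
    (le_sSup (Set.mem_image_of_mem G hM)).trans hs
  have hfin : G (fun ω => ⨅ n, Z n ω) ≠ ∞ := by
    refine ne_of_lt ((lintegral_mono fun ω => hφ1 _).trans_lt ?_)
    simp
  have heq := ae_eq_of_ae_le_of_lintegral_le
    (ae_of_all μ fun ω => hφa.antitone (min_le_left (⨅ n, Z n ω) (Z' ω)))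
    hfin (hφm.comp hM.1).aemeasurable hle
  filter_upwards [heq] with ω hω
  exact min_eq_left_iff.1 (hφa.injective hω).symm

/-- The essential supremum under `μ` of a family of extended real functions. -/
def essSupOf {Ω : Type*} {m : MeasurableSpace Ω} (μ : Measure Ω) [IsFiniteMeasure μ]
    (𝒮 : Set (Ω → EReal)) : Ω → EReal :=
  (exists_isEssSupOf μ 𝒮).choose

/-! ### The filtered probability space -/

/-- The usual assumptions, with `ℱ_∞ = m` generated by the filtration, and `ℱ_0` equal to the
σ-algebra of the sets that are null or have null complement (so the space is complete and every
`ℱ_t` contains all null sets). -/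
structure IsPricingBasis {Ω : Type*} {m : MeasurableSpace Ω} (P : Measure Ω)
    (𝓕 : Filtration ℝ≥0 m) : Prop where
  rightContinuous : 𝓕.IsRightContinuous
  iSup_eq : ⨆ t, 𝓕 t = m
  measurableSet_zero_iff : ∀ s : Set Ω, MeasurableSet[𝓕 0] s ↔ P s = 0 ∨ P sᶜ = 0

/-- Stopping times with values in `[0, ∞]`, ordered pointwise. -/
abbrev StopTime {Ω : Type*} {m : MeasurableSpace Ω} (𝓕 : Filtration ℝ≥0 m) : Type _ :=
  {τ : Ω → WithTop ℝ≥0 // IsStoppingTime 𝓕 τ}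

/-- The stopping time `0`. -/
def StopTime.zero {Ω : Type*} {m : MeasurableSpace Ω} (𝓕 : Filtration ℝ≥0 m) : StopTime 𝓕 :=
  ⟨fun _ => ((0 : ℝ≥0) : WithTop ℝ≥0), isStoppingTime_const 𝓕 0⟩

/-- The stopping time `∞`. -/
def StopTime.infty {Ω : Type*} {m : MeasurableSpace Ω} (𝓕 : Filtration ℝ≥0 m) : StopTime 𝓕 :=
  ⟨fun _ => ⊤, fun i => by simp⟩

/-- `L^∞(ℱ_τ)`, as a subspace of `L^∞(P)`. -/
def LInfty {Ω : Type*} {m : MeasurableSpace Ω} (P : Measure Ω) {𝓕 : Filtration ℝ≥0 m}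
    (τ : StopTime 𝓕) : Submodule ℝ (Lp ℝ ∞ P) :=
  lpMeas ℝ ℝ τ.2.measurableSpace ∞ P

/-! ### Pricing procedures -/

/-- A family of maps indexed by pairs of stopping times. Only the values `Π σ τ X` with `σ ≤ τ`
and `X ∈ L^∞(ℱ_τ)` are meaningful; every definition below refers to these values only. -/
abbrev PricingMaps {Ω : Type*} {m : MeasurableSpace Ω} (P : Measure Ω)
    (𝓕 : Filtration ℝ≥0 m) : Type _ :=
  StopTime 𝓕 → StopTime 𝓕 → Lp ℝ ∞ P → Lp ℝ ∞ P

/-- Dynamic pricing procedures. -/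
structure IsDynamicPricingProcedure {Ω : Type*} {m : MeasurableSpace Ω} (P : Measure Ω)
    (𝓕 : Filtration ℝ≥0 m) (Pi : PricingMaps P 𝓕) : Prop where
  mapsTo : ∀ σ τ : StopTime 𝓕, σ ≤ τ → ∀ X ∈ LInfty P τ, Pi σ τ X ∈ LInfty P σ
  monotone : ∀ σ τ : StopTime 𝓕, σ ≤ τ → ∀ X ∈ LInfty P τ, ∀ Y ∈ LInfty P τ,
    X ≤ Y → Pi σ τ X ≤ Pi σ τ Y
  translation : ∀ σ τ : StopTime 𝓕, σ ≤ τ → ∀ Z ∈ LInfty P σ, ∀ X ∈ LInfty P τ,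
    Pi σ τ (X + Z) = Pi σ τ X + Z
  convex : ∀ σ τ : StopTime 𝓕, σ ≤ τ → ∀ X ∈ LInfty P τ, ∀ Y ∈ LInfty P τ,
    ∀ c : ℝ, 0 ≤ c → c ≤ 1 →
      Pi σ τ (c • X + (1 - c) • Y) ≤ c • Pi σ τ X + (1 - c) • Pi σ τ Y
  normalized : ∀ σ τ : StopTime 𝓕, σ ≤ τ → Pi σ τ 0 = 0

/-- Time consistency. -/
def IsTimeConsistent {Ω : Type*} {m : MeasurableSpace Ω} (P : Measure Ω)
    (𝓕 : Filtration ℝ≥0 m) (Pi : PricingMaps P 𝓕) : Prop :=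
  ∀ ν σ τ : StopTime 𝓕, ν ≤ σ → σ ≤ τ → ∀ X ∈ LInfty P τ, Pi ν σ (Pi σ τ X) = Pi ν τ X

/-- Continuity from below. -/
def IsContinuousFromBelow {Ω : Type*} {m : MeasurableSpace Ω} (P : Measure Ω)
    (𝓕 : Filtration ℝ≥0 m) (Pi : PricingMaps P 𝓕) : Prop :=
  ∀ σ τ : StopTime 𝓕, σ ≤ τ → ∀ X : ℕ → Lp ℝ ∞ P, (∀ n, X n ∈ LInfty P τ) → Monotone X →
    ∀ Y ∈ LInfty P τ, (∀ᵐ ω ∂P, Tendsto (fun n => X n ω) atTop (𝓝 (Y ω))) →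
      ∀ᵐ ω ∂P, Tendsto (fun n => Pi σ τ (X n) ω) atTop (𝓝 (Pi σ τ Y ω))

/-- A TCPP: a time-consistent dynamic pricing procedure that is continuous from below. -/
structure IsTCPP {Ω : Type*} {m : MeasurableSpace Ω} (P : Measure Ω)
    (𝓕 : Filtration ℝ≥0 m) (Pi : PricingMaps P 𝓕) : Prop where
  pricing : IsDynamicPricingProcedure P 𝓕 Pi
  timeConsistent : IsTimeConsistent P 𝓕 Pi
  continuousFromBelow : IsContinuousFromBelow P 𝓕 Pi

/-- The weak* topology `σ(L^∞(P), L^1(P))`: the coarsest one for which all the functionals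
`X ↦ E_P[X g]`, `g ∈ L^1(P)`, are continuous. -/
@[reducible]
def weakStarTopology {Ω : Type*} {m : MeasurableSpace Ω} (P : Measure Ω) :
    TopologicalSpace (Lp ℝ ∞ P) :=
  TopologicalSpace.induced (fun X (g : Lp ℝ 1 P) => ∫ ω, X ω * g ω ∂P) Pi.topologicalSpace

/-- The cone generated by the claims that can be bought at time `0` at a non-positive price. -/
def superCone {Ω : Type*} {m : MeasurableSpace Ω} (P : Measure Ω)
    (𝓕 : Filtration ℝ≥0 m) (Pi : PricingMaps P 𝓕) : Set (Lp ℝ ∞ P) :=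
  {Y | ∃ c : ℝ, 0 ≤ c ∧ ∃ X ∈ LInfty P (StopTime.infty 𝓕),
    Pi (StopTime.zero 𝓕) (StopTime.infty 𝓕) X ≤ 0 ∧ Y = c • X}

/-- No (static) Free Lunch: the weak* closure of the cone meets `L^∞_+` only in `0`. -/
def NoFreeLunch {Ω : Type*} {m : MeasurableSpace Ω} (P : Measure Ω)
    (𝓕 : Filtration ℝ≥0 m) (Pi : PricingMaps P 𝓕) : Prop :=
  (@closure _ (weakStarTopology P) (superCone P 𝓕 Pi)) ∩ {X | 0 ≤ X} = {0}

/-! ### Penalties and dual representations -/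

/-- Equivalence of `Q` with the reference measure. -/
def IsEquivTo {Ω : Type*} {m : MeasurableSpace Ω} (P : Measure Ω) (Q : ProbabilityMeasure Ω) :
    Prop :=
  (Q : Measure Ω) ≪ P ∧ P ≪ (Q : Measure Ω)

/-- The minimal penalty
`α_{σ,τ}(Q) = Q-esssup { E_Q(X | ℱ_σ) - Π_{σ,τ}(X) | X ∈ L^∞(ℱ_τ) }`, for `Q ≪ P`. -/
def minPenalty {Ω : Type*} {m : MeasurableSpace Ω} {P : Measure Ω} {𝓕 : Filtration ℝ≥0 m}
    (Pi : PricingMaps P 𝓕) (Q : ProbabilityMeasure Ω) (σ τ : StopTime 𝓕) : Ω → EReal :=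
  essSupOf (Q : Measure Ω) {f | ∃ X ∈ LInfty P τ, f = fun ω =>
    (((Q : Measure Ω)[(X : Ω → ℝ) | σ.2.measurableSpace] ω - Pi σ τ X ω : ℝ) : EReal)}

/-- `Π_{σ,τ}(X) = esssup { E_Q(X | ℱ_σ) - α_{σ,τ}(Q) | Q ∈ 𝒬 }` for every `X ∈ L^∞(ℱ_τ)`. -/
def IsRepresentedAt {Ω : Type*} {m : MeasurableSpace Ω} (P : Measure Ω) [IsFiniteMeasure P]
    (𝓕 : Filtration ℝ≥0 m) (Pi : PricingMaps P 𝓕) (σ τ : StopTime 𝓕)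
    (𝒬 : Set (ProbabilityMeasure Ω)) : Prop :=
  ∀ X ∈ LInfty P τ, (fun ω => ((Pi σ τ X ω : ℝ) : EReal)) =ᵐ[P]
    essSupOf P {f | ∃ Q ∈ 𝒬, f = fun ω =>
      (((Q : Measure Ω)[(X : Ω → ℝ) | σ.2.measurableSpace] ω : ℝ) : EReal)
        - minPenalty Pi Q σ τ ω}

/-- The set `M^{1,e}_{σ,τ}(P)` of the probability measures `Q` equivalent to `P` that agree with
`P` on `ℱ_σ` and satisfy `E_Q(α_{σ,τ}(Q)) < ∞`. Only the restriction of `Q` to `ℱ_τ` matters. -/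
def condEquivMeasures {Ω : Type*} {m : MeasurableSpace Ω} (P : Measure Ω)
    (𝓕 : Filtration ℝ≥0 m) (Pi : PricingMaps P 𝓕) (σ τ : StopTime 𝓕) :
    Set (ProbabilityMeasure Ω) :=
  {Q | IsEquivTo P Q ∧
    (∀ A, MeasurableSet[σ.2.measurableSpace] A → (Q : Measure Ω) A = P A) ∧
    ∫⁻ ω, (minPenalty Pi Q σ τ ω).toENNReal ∂(Q : Measure Ω) < ∞}

/-! ### Reference assets -/

/-- `Z` is (almost surely) the value at `τ` of the process `S`; where `τ = ∞` this means that the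
limit of `S` at infinity exists and equals `Z`. -/
def IsValueAt {Ω : Type*} {m : MeasurableSpace Ω} (P : Measure Ω) (S : ℝ≥0 → Ω → ℝ)
    (τ : Ω → WithTop ℝ≥0) (Z : Ω → ℝ) : Prop :=
  ∀ᵐ ω ∂P, (∀ t : ℝ≥0, τ ω = t → Z ω = S t ω) ∧
    (τ ω = ⊤ → Tendsto (fun t => S t ω) atTop (𝓝 (Z ω)))

/-- Reference assets: adapted, locally bounded processes, the asset `0` being the numéraire. -/
structure IsMarket {Ω : Type*} {m : MeasurableSpace Ω} (P : Measure Ω) (𝓕 : Filtration ℝ≥0 m)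
    {d : ℕ} (S : Fin (d + 1) → ℝ≥0 → Ω → ℝ) : Prop where
  numeraire : ∀ t ω, S 0 t ω = 1
  adapted : ∀ k, Adapted 𝓕 (S k)
  locallyBounded : ∀ k, ∃ τ : ℕ → Ω → WithTop ℝ≥0, IsLocalizingSequence 𝓕 τ P ∧
    ∀ n, ∃ C : ℝ, ∀ᵐ ω ∂P, ∀ t : ℝ≥0,
      |stoppedValue (S k) (fun ω => min (t : WithTop ℝ≥0) (τ n ω)) ω| ≤ C

/-- The procedure extends the dynamics of `S`: `Π_{σ,τ}(n S^k_τ) = n S^k_σ` for all `k`, all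
integers `n` and all stopping times `σ ≤ τ` such that `S^k_τ ∈ L^∞(ℱ_τ)`. -/
def ExtendsDynamics {Ω : Type*} {m : MeasurableSpace Ω} (P : Measure Ω) (𝓕 : Filtration ℝ≥0 m)
    (Pi : PricingMaps P 𝓕) {d : ℕ} (S : Fin (d + 1) → ℝ≥0 → Ω → ℝ) : Prop :=
  ∀ (k : Fin (d + 1)) (n : ℤ) (σ τ : StopTime 𝓕), σ ≤ τ →
    ∀ X ∈ LInfty P τ, IsValueAt P (S k) τ.1 X →
    ∀ Y : Ω → ℝ, IsValueAt P (S k) σ.1 Y →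
      Pi σ τ ((n : ℝ) • X) =ᵐ[P] fun ω => (n : ℝ) * Y ω

/-- `E_Q(S^k_τ | ℱ_σ) = S^k_σ` for all `k` and all stopping times `σ₀ ≤ σ ≤ τ ≤ τ₀` such that
`S^k_τ ∈ L^∞(ℱ_τ)`. -/
def IsLocalMartingaleMeasureBetween {Ω : Type*} {m : MeasurableSpace Ω} (P : Measure Ω)
    (𝓕 : Filtration ℝ≥0 m) {d : ℕ} (S : Fin (d + 1) → ℝ≥0 → Ω → ℝ) (σ₀ τ₀ : StopTime 𝓕)
    (Q : ProbabilityMeasure Ω) : Prop :=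
  ∀ (k : Fin (d + 1)) (σ τ : StopTime 𝓕), σ₀ ≤ σ → σ ≤ τ → τ ≤ τ₀ →
    ∀ X ∈ LInfty P τ, IsValueAt P (S k) τ.1 X →
    ∀ Y : Ω → ℝ, IsValueAt P (S k) σ.1 Y →
      (Q : Measure Ω)[(X : Ω → ℝ) | σ.2.measurableSpace] =ᵐ[(Q : Measure Ω)] Y

/-- The set `M^e` of equivalent local martingale measures for `S`. -/
def equivLocalMartingaleMeasures {Ω : Type*} {m : MeasurableSpace Ω} (P : Measure Ω)
    (𝓕 : Filtration ℝ≥0 m) {d : ℕ} (S : Fin (d + 1) → ℝ≥0 → Ω → ℝ) :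
    Set (ProbabilityMeasure Ω) :=
  {Q | IsEquivTo P Q ∧
    IsLocalMartingaleMeasureBetween P 𝓕 S (StopTime.zero 𝓕) (StopTime.infty 𝓕) Q}

end

/-! ### Bounded random variables -/

section LInftyBasics

variable {Ω : Type*} {m : MeasurableSpace Ω} {P : Measure Ω}

/-! Everything is expressed through costless positions: `W` in `L^∞(ℱ_τ)` with `Π_{σ,τ}(W) = 0`.
Every `X - Π_{σ,τ}(X)` is one, so the minimal penalty of `Q` is the essential supremum of `E_Q(W |
ℱ_σ)` over costless `W`. By time-consistency, a position that is costless between later dates is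
costless from any earlier date up to `∞`.

No Free Lunch and a Kreps-Yan argument give `Q₀ ∼ P` under which no position costless at time `0`
has positive expectation (`IsTCPP.exists_equivalent_measure`). For `μ ∼ P`, the functional `r(Y) =
E_μ(Π_{σ,∞}(Y))` is convex, cash-additive and continuous from below. Hence for `c < r(X)` some `Q₂ ≪
P` satisfies `E_{Q₂}(Y) - r(Y) ≤ E_{Q₂}(X) - c` for all `Y`
(`IsCashFunctional.exists_dual_measure`). A small admixture of `Q₀`, pasted at `σ` onto `μ`, makes
this measure equivalent to `P` and keeps it nearly optimal (`IsTCPP.exists_approximating_measure`).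
Near-optimality in expectation becomes near-optimality of conditional expectations because costless
positions can be glued along events of `ℱ_σ`. Letting the error tend to `0` gives the representation
(`IsTCPP.isRepresentedAt`).

Under the approximating measures the expectations of the relevant costless positions are bounded
above. If the procedure extends the dynamics, then `n • (S^k_τ - S^k_σ)` on any event of `ℱ_σ` is
costless for every integer `n`, so boundedness forces its expectation to vanish. The approximating
measures are therefore local martingale measures, and the same bound makes their penalties finite.
Taking `μ = Q₀` gives the second representation, hence the first; taking `μ = P` gives the third.

Conversely, all local martingale measures assign the same conditional expectation `n S^k_σ` to `n
S^k_τ`. It leaves the essential supremum, and what remains is the representation of `Π_{σ,τ}(0) =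
0`. -/

theorem MeasureTheory.Lp.ae_abs_le_norm (X : Lp ℝ ∞ P) : ∀ᵐ ω ∂P, |X ω| ≤ ‖X‖ := by
  have h := ae_le_eLpNormEssSup (f := (X : Ω → ℝ)) (μ := P)
  have hX : eLpNormEssSup X P = ENNReal.ofReal ‖X‖ := by
    rw [Lp.norm_def, eLpNorm_exponent_top, ENNReal.ofReal_toReal]
    rw [← eLpNorm_exponent_top]
    exact Lp.eLpNorm_ne_top X
  filter_upwards [h] with ω hω
  rw [hX, ← ofReal_norm, ENNReal.ofReal_le_ofReal_iff (norm_nonneg _)] at hω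
  simpa using hω

theorem integrable_linfty {Q : Measure Ω} [IsFiniteMeasure Q]
    (hQ : Q ≪ P) (X : Lp ℝ ∞ P) : Integrable X Q :=
  Integrable.of_bound (Lp.stronglyMeasurable X).aestronglyMeasurable ‖X‖
    (hQ.ae_le (Lp.ae_abs_le_norm X))

theorem exists_Lp_top_of_bound {f : Ω → ℝ} (hf : AEStronglyMeasurable f P) {C : ℝ}
    (hC : ∀ᵐ ω ∂P, |f ω| ≤ C) : ∃ X : Lp ℝ ∞ P, X =ᵐ[P] f :=
  ⟨(memLp_top_of_bound hf C hC).toLp f, MemLp.coeFn_toLp _⟩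

theorem MeasureTheory.Lp.const_ae [IsFiniteMeasure P] (c : ℝ) :
    (Lp.const ∞ P c : Lp ℝ ∞ P) =ᵐ[P] fun _ => c := Lp.coeFn_const ..

theorem MeasureTheory.Lp.ae_of_le {X Y : Lp ℝ ∞ P} (h : X ≤ Y) : X ≤ᵐ[P] Y := (Lp.coeFn_le _ _).2 h

theorem linfty_smul_le_smul {t : ℝ} (ht : 0 ≤ t) {X Y : Lp ℝ ∞ P} (h : X ≤ Y) : t • X ≤ t • Y := by
  rw [← Lp.coeFn_le]
  filter_upwards [Lp.ae_of_le h, Lp.coeFn_smul t X, Lp.coeFn_smul t Y] with ω h1 h2 h3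
  rw [h2, h3]
  exact mul_le_mul_of_nonneg_left h1 ht

theorem integral_mono_of_linfty_le {Q : Measure Ω} [IsFiniteMeasure Q] (hQ : Q ≪ P)
    {X Y : Lp ℝ ∞ P} (h : X ≤ Y) : ∫ ω, X ω ∂Q ≤ ∫ ω, Y ω ∂Q :=
  integral_mono_ae (integrable_linfty hQ X)
    (integrable_linfty hQ Y) (hQ.ae_le (Lp.ae_of_le h))

theorem integral_linfty_add {Q : Measure Ω} [IsFiniteMeasure Q] (hQ : Q ≪ P) (X Y : Lp ℝ ∞ P) :
    ∫ ω, (X + Y) ω ∂Q = ∫ ω, X ω ∂Q + ∫ ω, Y ω ∂Q := by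
  rw [← integral_add (integrable_linfty hQ X)
    (integrable_linfty hQ Y)]
  exact integral_congr_ae (hQ.ae_le (Lp.coeFn_add X Y))

theorem integral_linfty_sub {Q : Measure Ω} [IsFiniteMeasure Q] (hQ : Q ≪ P) (X Y : Lp ℝ ∞ P) :
    ∫ ω, (X - Y) ω ∂Q = ∫ ω, X ω ∂Q - ∫ ω, Y ω ∂Q := by
  rw [← integral_sub (integrable_linfty hQ X)
    (integrable_linfty hQ Y)]
  exact integral_congr_ae (hQ.ae_le (Lp.coeFn_sub X Y))

theorem integral_linfty_smul {Q : Measure Ω} (hQ : Q ≪ P) (c : ℝ) (X : Lp ℝ ∞ P) :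
    ∫ ω, (c • X) ω ∂Q = c * ∫ ω, X ω ∂Q := by
  rw [← integral_const_mul]
  exact integral_congr_ae (hQ.ae_le (Lp.coeFn_smul c X))

end LInftyBasics

/-! ### Forward convex combinations -/

/-- Nested nonempty convex sets whose images are bounded in an inner product space contain a
sequence with Cauchy images. -/
theorem exists_cauchySeq_of_antitone_convex {V E : Type*} [AddCommGroup V] [Module ℝ V]
    [NormedAddCommGroup E] [InnerProductSpace ℝ E] (T : V →ₗ[ℝ] E) (C : ℕ → Set V)
    (hC : Antitone C) (hconv : ∀ n, Convex ℝ (C n)) (hne : ∀ n, (C n).Nonempty) (R : ℝ)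
    (hR : ∀ z ∈ C 0, ‖T z‖ ≤ R) :
    ∃ z : ℕ → V, (∀ n, z n ∈ C n) ∧ CauchySeq fun n => T (z n) := by
  have hR' : ∀ n, ∀ z ∈ C n, ‖T z‖ ^ 2 ≤ R ^ 2 := fun n z hz =>
    pow_le_pow_left₀ (norm_nonneg _) (hR z (hC (Nat.zero_le n) hz)) 2
  let q : ℕ → ℝ := fun n => sInf ((fun z => ‖T z‖ ^ 2) '' C n)
  have hbd : ∀ n, BddBelow ((fun z => ‖T z‖ ^ 2) '' C n) := fun n =>
    ⟨0, by rintro _ ⟨z, -, rfl⟩; positivity⟩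
  have hq : ∀ n, ∀ z ∈ C n, q n ≤ ‖T z‖ ^ 2 := fun n z hz => csInf_le (hbd n) ⟨z, hz, rfl⟩
  -- Almost minimal squared norms: the infima `q n` increase to a finite limit, so the parallelogram
  -- law will force such elements together.
  have hz : ∀ n : ℕ, ∃ z ∈ C n, ‖T z‖ ^ 2 < q n + 1 / ((n : ℝ) + 1) := by
    intro n
    obtain ⟨_, ⟨z, hz, rfl⟩, h⟩ := exists_lt_of_csInf_lt ((hne n).image fun z => ‖T z‖ ^ 2)
      (show q n < q n + 1 / ((n : ℝ) + 1) from lt_add_of_pos_right _ (by positivity))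
    exact ⟨z, hz, h⟩
  choose z hzC hzq using hz
  have hqm : Monotone q := fun a b hab =>
    csInf_le_csInf (hbd a) ((hne b).image _) (Set.image_mono (hC hab))
  have hqt : Tendsto q atTop (𝓝 (⨆ n, q n)) := by
    refine tendsto_atTop_ciSup hqm ⟨R ^ 2, ?_⟩
    rintro _ ⟨n, rfl⟩
    exact (hq n _ (hzC n)).trans (hR' n _ (hzC n))
  refine ⟨z, hzC, Metric.cauchySeq_iff'.2 fun ε hε => ?_⟩
  have h1 : ∀ᶠ n in atTop, (⨆ n, q n) - ε ^ 2 / 16 < q n :=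
    hqt.eventually (lt_mem_nhds (by linarith [show 0 < ε ^ 2 / 16 by positivity]))
  have h2 : ∀ᶠ n : ℕ in atTop, 1 / ((n : ℝ) + 1) < ε ^ 2 / 16 :=
    tendsto_one_div_add_atTop_nhds_zero_nat.eventually (gt_mem_nhds (by positivity))
  obtain ⟨N, hN1, hN2⟩ := (h1.and h2).exists
  refine ⟨N, fun n hn => ?_⟩
  -- The midpoint lies in `C N`, so its squared norm is at least `q N`; hence `‖T (z n) - T (z N)‖ ^
  -- 2` is at most `2 * (q n - q N) + 4 / (N + 1)`, below `6 / 16 * ε ^ 2`.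
  have hmid : (1 / 2 : ℝ) • z n + (1 / 2 : ℝ) • z N ∈ C N :=
    hconv N (hC hn (hzC n)) (hzC N) (by norm_num) (by norm_num) (by norm_num)
  have h3 := hq N _ hmid
  have hpar := parallelogram_law_with_norm ℝ (T (z n)) (T (z N))
  have h4 : ‖T ((1 / 2 : ℝ) • z n + (1 / 2 : ℝ) • z N)‖ = 1 / 2 * ‖T (z n) + T (z N)‖ := by
    rw [map_add, map_smul, map_smul, ← smul_add, norm_smul]
    norm_num
  rw [h4] at h3
  have h5 : q n ≤ ⨆ n, q n := hqm.ge_of_tendsto hqt n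
  have h6 : 1 / ((n : ℝ) + 1) ≤ 1 / ((N : ℝ) + 1) := by gcongr
  have h7 := hzq n
  have h8 := hzq N
  have : ‖T (z n) - T (z N)‖ ^ 2 < ε ^ 2 := by nlinarith
  rw [dist_eq_norm]
  exact lt_of_pow_lt_pow_left₀ 2 hε.le this

section AEConvergence

variable {Ω : Type*} {m : MeasurableSpace Ω} {P : Measure Ω} [IsProbabilityMeasure P]

/-- The inclusion of `L^∞` in `L^2`. -/
noncomputable def linftyToL2 (P : Measure Ω) [IsProbabilityMeasure P] :
    Lp ℝ ∞ P →ₗ[ℝ] Lp ℝ 2 P where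
  toFun X := ((Lp.memLp X).mono_exponent le_top).toLp X
  map_add' X Y := by
    rw [← MemLp.toLp_add]
    exact MemLp.toLp_congr _ _ (Lp.coeFn_add X Y)
  map_smul' c X := by
    rw [RingHom.id_apply, ← MemLp.toLp_const_smul]
    exact MemLp.toLp_congr _ _ (Lp.coeFn_smul c X)

theorem linftyToL2_ae (X : Lp ℝ ∞ P) : linftyToL2 P X =ᵐ[P] X :=
  MemLp.coeFn_toLp ((Lp.memLp X).mono_exponent (p := 2) le_top)

/-- Convexity and uniform bounds replace compactness: `L^2`-Cauchy members exist by the Hilbert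
space argument, and a subsequence converges almost surely. -/
theorem exists_ae_tendsto_of_antitone_convex (C : ℕ → Set (Lp ℝ ∞ P)) (hC : Antitone C)
    (hconv : ∀ n, Convex ℝ (C n)) (hne : ∀ n, (C n).Nonempty) {R : ℝ} (hR0 : 0 ≤ R)
    (hR : ∀ z ∈ C 0, ∀ᵐ ω ∂P, |z ω| ≤ R) :
    ∃ z : ℕ → Lp ℝ ∞ P, (∀ n, z n ∈ C n) ∧ ∃ Z : Lp ℝ ∞ P,
      ∀ᵐ ω ∂P, Tendsto (fun n => z n ω) atTop (𝓝 (Z ω)) := by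
  obtain ⟨z, hz, hcs⟩ := exists_cauchySeq_of_antitone_convex (linftyToL2 P) C hC hconv hne R
    (by
      intro z hz
      have h := Lp.norm_le_of_ae_bound (f := linftyToL2 P z) hR0 (by
        filter_upwards [hR z hz, linftyToL2_ae z] with ω h1 h2
        rw [h2]
        exact h1)
      simpa [measureUnivNNReal] using h)
  obtain ⟨Y, hY⟩ := cauchySeq_tendsto_of_complete hcs
  obtain ⟨φ, hφ, hφY⟩ := (tendstoInMeasure_of_tendsto_Lp hY).exists_seq_tendsto_ae
  have hlim : ∀ᵐ ω ∂P, Tendsto (fun n => z (φ n) ω) atTop (𝓝 (Y ω)) := by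
    have h2 : ∀ᵐ ω ∂P, ∀ n, linftyToL2 P (z n) ω = z n ω := ae_all_iff.2 fun n => linftyToL2_ae (z n)
    filter_upwards [hφY, h2] with ω h1 h2
    simpa only [h2] using h1
  have hbound : ∀ᵐ ω ∂P, |Y ω| ≤ R := by
    have h2 : ∀ᵐ ω ∂P, ∀ n, |z n ω| ≤ R := ae_all_iff.2 fun n => hR _ (hC (Nat.zero_le n) (hz n))
    filter_upwards [hlim, h2] with ω h1 h2
    exact le_of_tendsto h1.abs (Eventually.of_forall fun n => h2 _)
  obtain ⟨Z, hZ⟩ := exists_Lp_top_of_bound (Lp.stronglyMeasurable Y).aestronglyMeasurable hbound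
  -- Since `φ n ≥ n`, nestedness keeps the subsequence in the sets with the original indices.
  refine ⟨fun n => z (φ n), fun n => hC (hφ.id_le n) (hz _), Z, ?_⟩
  filter_upwards [hlim, hZ] with ω h1 h2
  rwa [h2]

end AEConvergence

/-! ### Positive functionals continuous along bounded almost sure convergence -/

section Functionals

variable {Ω : Type*} {m : MeasurableSpace Ω} {P : Measure Ω} [IsProbabilityMeasure P]

theorem indicatorConstLp_top_ae {A : Set Ω} (hA : MeasurableSet A) :
    (indicatorConstLp ∞ hA (measure_ne_top P A) (1 : ℝ) : Lp ℝ ∞ P) =ᵐ[P]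
      A.indicator fun _ => 1 := indicatorConstLp_coeFn

/-- The measure is `A ↦ f(1_A)`. Tails of a disjoint union are bounded by `1` and vanish pointwise
in the limit, so `hcont` gives countable additivity; bounded simple approximations extend the
formula to all of `L^∞`. -/
theorem exists_measure_of_positive_functional (f : Lp ℝ ∞ P →ₗ[ℝ] ℝ) (hpos : ∀ Z, 0 ≤ Z → 0 ≤ f Z)
    (hcont : ∀ (z : ℕ → Lp ℝ ∞ P) (R : ℝ), (∀ n, ∀ᵐ ω ∂P, |z n ω| ≤ R) →
      (∀ᵐ ω ∂P, Tendsto (fun n => z n ω) atTop (𝓝 0)) → Tendsto (fun n => f (z n)) atTop (𝓝 0)) :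
    ∃ ν : Measure Ω, IsFiniteMeasure ν ∧ ν ≪ P ∧ ∀ X : Lp ℝ ∞ P, f X = ∫ ω, X ω ∂ν := by
  classical
  let I : ∀ A : Set Ω, MeasurableSet A → Lp ℝ ∞ P := fun A hA =>
    indicatorConstLp ∞ hA (measure_ne_top P A) (1 : ℝ)
  have hI : ∀ A hA, (I A hA) =ᵐ[P] A.indicator fun _ => (1 : ℝ) := fun A hA =>
    indicatorConstLp_top_ae hA
  have hI0 : ∀ A hA, 0 ≤ f (I A hA) := fun A hA => hpos _ <| by
    rw [← Lp.coeFn_nonneg]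
    filter_upwards [hI A hA] with ω h
    rw [h]
    exact Set.indicator_nonneg (fun _ _ => zero_le_one) ω
  let ν : Measure Ω := Measure.ofMeasurable (fun A hA => ENNReal.ofReal (f (I A hA)))
    (by
      have : I ∅ MeasurableSet.empty = 0 := by
        apply Lp.ext
        filter_upwards [hI ∅ MeasurableSet.empty, Lp.coeFn_zero ℝ ∞ P] with ω h1 h2
        rw [h1, h2]
        simp
      simp [this])
    (by
      intro A hA hd
      have hp : ∀ n : ℕ, ∑ i ∈ Finset.range n, f (I (A i) (hA i)) =
          f (I (⋃ i, A i) (MeasurableSet.iUnion hA)) -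
            f (I (⋃ i, A i) (MeasurableSet.iUnion hA) - ∑ i ∈ Finset.range n, I (A i) (hA i)) := by
        intro n
        rw [map_sub, map_sum]
        ring
      have hsum : ∀ n : ℕ, ∀ᵐ ω ∂P,
          (I (⋃ i, A i) (MeasurableSet.iUnion hA) - ∑ i ∈ Finset.range n, I (A i) (hA i) :
            Lp ℝ ∞ P) ω = (⋃ i, A i).indicator (fun _ => (1 : ℝ)) ω -
              ∑ i ∈ Finset.range n, (A i).indicator (fun _ => (1 : ℝ)) ω := by
        intro n
        have h3 : ∀ᵐ ω ∂P, ∀ i, I (A i) (hA i) ω = (A i).indicator (fun _ => (1 : ℝ)) ω :=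
          ae_all_iff.2 fun i => hI _ _
        filter_upwards [Lp.coeFn_sub (I (⋃ i, A i) (MeasurableSet.iUnion hA))
          (∑ i ∈ Finset.range n, I (A i) (hA i)), hI _ (MeasurableSet.iUnion hA), h3,
          Lp.coeFn_finsetSum (Finset.range n) fun i => I (A i) (hA i)] with ω h1 h2 h3 h4
        rw [h1, Pi.sub_apply, h2, h4]
        simp [h3]
      have hind : ∀ (n : ℕ) (ω : Ω), ∑ i ∈ Finset.range n, (A i).indicator (fun _ => (1 : ℝ)) ω =
          (⋃ i ∈ Finset.range n, A i).indicator (fun _ => (1 : ℝ)) ω := by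
        intro n ω
        rw [Finset.indicator_biUnion _ _ fun i _ j _ hij => hd hij]
      have ht := hcont (fun n => I (⋃ i, A i) (MeasurableSet.iUnion hA) -
          ∑ i ∈ Finset.range n, I (A i) (hA i)) 1 (fun n => by
            filter_upwards [hsum n] with ω h
            rw [h, hind, Set.indicator_apply, Set.indicator_apply]
            split_ifs <;> norm_num)
          (by
            filter_upwards [ae_all_iff.2 hsum] with ω h
            refine tendsto_const_nhds.congr' ?_
            by_cases h1 : ω ∈ ⋃ i, A i
            · obtain ⟨i, hi⟩ := Set.mem_iUnion.1 h1
              filter_upwards [eventually_gt_atTop i] with n hn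
              have h2 : ω ∈ ⋃ i ∈ Finset.range n, A i := by
                simp only [Finset.mem_range, Set.mem_iUnion, exists_prop]
                exact ⟨i, hn, hi⟩
              rw [h n, hind, Set.indicator_of_mem h1, Set.indicator_of_mem h2, sub_self]
            · filter_upwards with n
              have h2 : ω ∉ ⋃ i ∈ Finset.range n, A i := fun h2 => h1 (by
                simp only [Finset.mem_range, Set.mem_iUnion, exists_prop] at h2 ⊢
                exact ⟨h2.choose, h2.choose_spec.2⟩)
              rw [h n, hind, Set.indicator_of_notMem h1, Set.indicator_of_notMem h2, sub_self])
      have hs : HasSum (fun i => f (I (A i) (hA i))) (f (I (⋃ i, A i) (MeasurableSet.iUnion hA))) := by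
        rw [hasSum_iff_tendsto_nat_of_nonneg fun i => hI0 _ _]
        simp_rw [hp]
        have h := (tendsto_const_nhds (x := f (I (⋃ i, A i) (MeasurableSet.iUnion hA)))).sub ht
        rwa [sub_zero] at h
      rw [← ENNReal.ofReal_tsum_of_nonneg (fun i => hI0 _ _) hs.summable, hs.tsum_eq])
  have hν : ∀ A (hA : MeasurableSet A), ν A = ENNReal.ofReal (f (I A hA)) := fun A hA =>
    Measure.ofMeasurable_apply A hA
  have hfin : IsFiniteMeasure ν := ⟨by rw [hν _ MeasurableSet.univ]; exact ENNReal.ofReal_lt_top⟩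
  have hac : ν ≪ P := by
    refine Measure.AbsolutelyContinuous.mk fun A hA hPA => ?_
    have : I A hA = 0 := by
      apply Lp.ext
      filter_upwards [hI A hA, Lp.coeFn_zero ℝ ∞ P, measure_eq_zero_iff_ae_notMem.1 hPA]
        with ω h1 h2 h3
      rw [h1, h2, Set.indicator_of_notMem h3]
      rfl
    rw [hν A hA, this, map_zero, ENNReal.ofReal_zero]
  refine ⟨ν, hfin, hac, fun X => ?_⟩
  have hsimple : ∀ s : SimpleFunc Ω ℝ, ∀ Y : Lp ℝ ∞ P, Y =ᵐ[P] s → f Y = ∫ ω, s ω ∂ν := by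
    intro s
    induction s using SimpleFunc.induction with
    | const c hA =>
      rename_i A
      intro Y hY
      have : Y = c • I A hA := by
        apply Lp.ext
        filter_upwards [hY, hI A hA, Lp.coeFn_smul c (I A hA)] with ω h1 h2 h3
        rw [h1, h3, Pi.smul_apply, h2]
        by_cases h : ω ∈ A <;> simp [h]
      have h : ⇑(SimpleFunc.piecewise A hA (SimpleFunc.const Ω c) (SimpleFunc.const Ω 0)) =
          A.indicator fun _ => c := by
        ext ω
        by_cases h : ω ∈ A <;> simp [h]
      rw [this, map_smul, h, integral_indicator_const _ hA, measureReal_def, hν A hA,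
        ENNReal.toReal_ofReal (hI0 _ _), smul_eq_mul, smul_eq_mul, mul_comm]
    | add hd h1 h2 =>
      rename_i s t
      intro Y hY
      have hb : ∀ u : SimpleFunc Ω ℝ, ∃ U : Lp ℝ ∞ P, U =ᵐ[P] u := by
        intro u
        obtain ⟨C, hC⟩ := u.exists_forall_norm_le
        exact exists_Lp_top_of_bound u.stronglyMeasurable.aestronglyMeasurable
          (ae_of_all _ fun ω => hC ω)
      have hi : ∀ u : SimpleFunc Ω ℝ, Integrable u ν := fun u => by
        obtain ⟨C, hC⟩ := u.exists_forall_norm_le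
        exact Integrable.of_bound u.stronglyMeasurable.aestronglyMeasurable C (ae_of_all _ hC)
      obtain ⟨U, hU⟩ := hb s
      obtain ⟨V, hV⟩ := hb t
      have : Y = U + V := by
        apply Lp.ext
        filter_upwards [hY, hU, hV, Lp.coeFn_add U V] with ω h1 h2 h3 h4
        rw [h1, h4, Pi.add_apply, h2, h3]
        rfl
      rw [this, map_add, h1 U hU, h2 V hV, ← integral_add (hi s) (hi t)]
      rfl
  have hXm := Lp.stronglyMeasurable X
  let s : ℕ → SimpleFunc Ω ℝ := hXm.approxBounded ‖X‖
  have hsb : ∀ n ω, ‖s n ω‖ ≤ ‖X‖ := fun n ω => hXm.norm_approxBounded_le (norm_nonneg _) n ω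
  have hst : ∀ᵐ ω ∂P, Tendsto (fun n => s n ω) atTop (𝓝 (X ω)) :=
    hXm.tendsto_approxBounded_ae (by simpa using Lp.ae_abs_le_norm X)
  have hY : ∀ n, ∃ Y : Lp ℝ ∞ P, Y =ᵐ[P] s n := fun n =>
    exists_Lp_top_of_bound (s n).stronglyMeasurable.aestronglyMeasurable
      (ae_of_all _ fun ω => hsb n ω)
  choose Y hY using hY
  have ht1 : Tendsto (fun n => f (Y n)) atTop (𝓝 (f X)) := by
    have h := hcont (fun n => Y n - X) (‖X‖ + ‖X‖)
      (fun n => by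
        filter_upwards [hY n, Lp.coeFn_sub (Y n) X, Lp.ae_abs_le_norm X] with ω h1 h2 h3
        rw [h2, Pi.sub_apply, h1]
        exact (abs_sub _ _).trans (add_le_add (hsb n ω) h3))
      (by
        filter_upwards [ae_all_iff.2 hY, ae_all_iff.2 fun n => Lp.coeFn_sub (Y n) X, hst]
          with ω h1 h2 h3
        simp only [h2, Pi.sub_apply, h1]
        simpa using h3.sub_const (X ω))
    simpa using (h.add_const (f X))
  have ht2 : Tendsto (fun n => f (Y n)) atTop (𝓝 (∫ ω, X ω ∂ν)) := by
    simp_rw [fun n => hsimple (s n) (Y n) (hY n)]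
    exact tendsto_integral_of_dominated_convergence (fun _ => ‖X‖)
      (fun n => (s n).stronglyMeasurable.aestronglyMeasurable) (integrable_const _)
      (fun n => ae_of_all _ (hsb n)) (hac.ae_le hst)
  exact tendsto_nhds_unique ht1 ht2

end Functionals

/-! ### Dual representation of cash-additive convex functionals -/

section Static

variable {Ω : Type*} {m : MeasurableSpace Ω}

/-- Monotone convex cash-additive functionals on `L^∞` that are continuous from below. -/
structure IsCashFunctional (P : Measure Ω) [IsFiniteMeasure P] (ρ : Lp ℝ ∞ P → ℝ) : Prop where
  mono : Monotone ρ
  convex : ConvexOn ℝ Set.univ ρ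
  add_const : ∀ X c, ρ (X + Lp.const ∞ P c) = ρ X + c
  tendsto_of_monotone : ∀ X : ℕ → Lp ℝ ∞ P, Monotone X → ∀ Y : Lp ℝ ∞ P,
    (∀ᵐ ω ∂P, Tendsto (fun n => X n ω) atTop (𝓝 (Y ω))) →
      Tendsto (fun n => ρ (X n)) atTop (𝓝 (ρ Y))

variable {P : Measure Ω} [IsProbabilityMeasure P] {ρ : Lp ℝ ∞ P → ℝ}

/-- The tail infima of `z` increase to `Z` and lie below `z`, so continuity from below and
monotonicity suffice. -/
theorem IsCashFunctional.fatou (hρ : IsCashFunctional P ρ) {z : ℕ → Lp ℝ ∞ P} {Z : Lp ℝ ∞ P}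
    {R c : ℝ} (hR : ∀ n, ∀ᵐ ω ∂P, |z n ω| ≤ R) (hc : ∀ n, ρ (z n) ≤ c)
    (hz : ∀ᵐ ω ∂P, Tendsto (fun n => z n ω) atTop (𝓝 (Z ω))) : ρ Z ≤ c := by
  have hR' : ∀ᵐ ω ∂P, ∀ n, |z n ω| ≤ R := ae_all_iff.2 hR
  have hex : ∀ n, ∃ Y : Lp ℝ ∞ P, Y =ᵐ[P] fun ω => ⨅ k, z (n + k) ω := by
    intro n
    refine exists_Lp_top_of_bound (C := R) (Measurable.iInf fun k =>
      (Lp.stronglyMeasurable (z (n + k))).measurable).aestronglyMeasurable ?_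
    filter_upwards [hR'] with ω h
    rw [abs_le]
    exact ⟨le_ciInf fun k => (abs_le.1 (h _)).1, (ciInf_le ⟨-R, by
      rintro _ ⟨k, rfl⟩
      exact (abs_le.1 (h _)).1⟩ 0).trans (abs_le.1 (h _)).2⟩
  choose Y hY using hex
  have hbdd : ∀ᵐ ω ∂P, ∀ n, BddBelow (Set.range fun k => z (n + k) ω) := by
    filter_upwards [hR'] with ω h n
    exact ⟨-R, by rintro _ ⟨k, rfl⟩; exact (abs_le.1 (h _)).1⟩
  have hmono : Monotone Y := by
    refine monotone_nat_of_le_succ fun n => ?_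
    rw [← Lp.coeFn_le]
    filter_upwards [hY n, hY (n + 1), hbdd] with ω h1 h2 h3
    rw [h1, h2]
    refine le_ciInf fun k => (ciInf_le (h3 n) (k + 1)).trans_eq ?_
    rw [show n + (k + 1) = n + 1 + k by omega]
  have hle : ∀ n, Y n ≤ z n := by
    intro n
    rw [← Lp.coeFn_le]
    filter_upwards [hY n, hbdd] with ω h1 h3
    rw [h1]
    exact (ciInf_le (h3 n) 0)
  have ht := hρ.tendsto_of_monotone Y hmono Z (by
    filter_upwards [ae_all_iff.2 hY, hbdd, hz] with ω h1 h3 h4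
    simp only [h1]
    rw [Metric.tendsto_atTop] at h4 ⊢
    intro ε hε
    obtain ⟨N, hN⟩ := h4 (ε / 2) (by positivity)
    refine ⟨N, fun n hn => ?_⟩
    have h5 : ∀ k, |z (n + k) ω - Z ω| < ε / 2 := fun k => hN _ (by omega)
    rw [Real.dist_eq, abs_lt]
    have h6 : Z ω - ε / 2 ≤ ⨅ k, z (n + k) ω :=
      le_ciInf fun k => by linarith [(abs_lt.1 (h5 k)).1]
    have h7 := ciInf_le (h3 n) 0
    have h8 := (abs_lt.1 (h5 0)).2
    constructor <;> linarith)
  exact le_of_tendsto ht (Eventually.of_forall fun n => (hρ.mono (hle n)).trans (hc n))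

/-- The expected excess of a random variable over a level. -/
noncomputable def expectedExcess (P : Measure Ω) (Z : Lp ℝ ∞ P) (a : ℝ) : ℝ :=
  ∫ ω, max (Z ω - a) 0 ∂P

theorem integrable_excess (Z : Lp ℝ ∞ P) (a : ℝ) : Integrable (fun ω => max (Z ω - a) 0) P :=
  ((integrable_linfty Measure.AbsolutelyContinuous.rfl Z).sub (integrable_const a)).pos_part

theorem convex_expectedExcess_le (a b : ℝ) : Convex ℝ {Z : Lp ℝ ∞ P | expectedExcess P Z a ≤ b} := by
  intro Z hZ Y hY s t hs ht hst
  have h : expectedExcess P (s • Z + t • Y) a ≤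
      s * expectedExcess P Z a + t * expectedExcess P Y a := by
    unfold expectedExcess
    rw [← integral_const_mul, ← integral_const_mul, ← integral_add
      ((integrable_excess Z a).const_mul s) ((integrable_excess Y a).const_mul t)]
    refine integral_mono_ae (integrable_excess _ _)
      (((integrable_excess Z a).const_mul s).add ((integrable_excess Y a).const_mul t)) ?_
    filter_upwards [Lp.coeFn_add (s • Z) (t • Y), Lp.coeFn_smul s Z, Lp.coeFn_smul t Y]
      with ω h1 h2 h3
    rw [h1, Pi.add_apply, h2, h3]
    simp only [Pi.smul_apply, smul_eq_mul]
    refine max_le ?_ (by positivity)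
    have h4 := mul_le_mul_of_nonneg_left (le_max_left (Z ω - a) 0) hs
    have h5 := mul_le_mul_of_nonneg_left (le_max_left (Y ω - a) 0) ht
    have h6 : a = s * a + t * a := by rw [← add_mul, hst, one_mul]
    linarith
  refine h.trans ((add_le_add (mul_le_mul_of_nonneg_left hZ hs)
    (mul_le_mul_of_nonneg_left hY ht)).trans_eq ?_)
  rw [← add_mul, hst, one_mul]

theorem IsCashFunctional.convex_acceptable (hρ : IsCashFunctional P ρ) (X : Lp ℝ ∞ P) (c : ℝ) :
    Convex ℝ {Z | ρ (X - Z) ≤ c} := by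
  intro Z hZ Y hY s t hs ht hst
  have h : X - (s • Z + t • Y) = s • (X - Z) + t • (X - Y) := by
    have : X = s • X + t • X := by rw [← add_smul, hst, one_smul]
    rw [smul_sub, smul_sub]
    nth_rewrite 1 [this]
    abel
  change ρ _ ≤ c
  rw [h]
  refine (hρ.convex.2 (Set.mem_univ _) (Set.mem_univ _) hs ht hst).trans
    ((add_le_add (mul_le_mul_of_nonneg_left hZ hs)
    (mul_le_mul_of_nonneg_left hY ht)).trans_eq ?_)
  rw [← add_mul, hst, one_mul]

/-- Nonnegative positions `Z ≤ k` with `ρ (X - Z) ≤ c` and small expected excesses. -/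
def excessConstrained (P : Measure Ω) [IsFiniteMeasure P] (ρ : Lp ℝ ∞ P → ℝ) (X : Lp ℝ ∞ P)
    (c : ℝ) (δ : ℕ → ℝ) (k : ℕ) : Set (Lp ℝ ∞ P) :=
  {Z | (0 ≤ Z ∧ Z ≤ Lp.const ∞ P (k : ℝ)) ∧ ρ (X - Z) ≤ c ∧ ∀ j < k, expectedExcess P Z j ≤ δ j}

theorem IsCashFunctional.convex_excessConstrained (hρ : IsCashFunctional P ρ) (X : Lp ℝ ∞ P)
    (c : ℝ) (δ : ℕ → ℝ) (k : ℕ) : Convex ℝ (excessConstrained P ρ X c δ k) := by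
  intro Z hZ Y hY s t hs ht hst
  refine ⟨⟨?_, ?_⟩, hρ.convex_acceptable X c hZ.2.1 hY.2.1 hs ht hst, fun j hj =>
    convex_expectedExcess_le (j : ℝ) (δ j) (hZ.2.2 j hj) (hY.2.2 j hj) hs ht hst⟩
  · have h1 := Lp.ae_of_le hZ.1.1
    have h2 := Lp.ae_of_le hY.1.1
    rw [← Lp.coeFn_le]
    filter_upwards [h1, h2, Lp.coeFn_zero ℝ ∞ P, Lp.coeFn_add (s • Z) (t • Y), Lp.coeFn_smul s Z,
      Lp.coeFn_smul t Y] with ω h1 h2 h3 h4 h5 h6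
    rw [h3] at h1 h2 ⊢
    rw [h4, Pi.add_apply, h5, h6]
    exact add_nonneg (mul_nonneg hs h1) (mul_nonneg ht h2)
  · have h1 := Lp.ae_of_le hZ.1.2
    have h2 := Lp.ae_of_le hY.1.2
    rw [← Lp.coeFn_le]
    filter_upwards [h1, h2, Lp.const_ae (P := P) (k : ℝ), Lp.coeFn_add (s • Z) (t • Y),
      Lp.coeFn_smul s Z, Lp.coeFn_smul t Y] with ω h1 h2 h3 h4 h5 h6
    rw [h3] at h1 h2 ⊢
    rw [h4, Pi.add_apply, h5, h6]
    refine (add_le_add (mul_le_mul_of_nonneg_left h1 hs)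
      (mul_le_mul_of_nonneg_left h2 ht)).trans_eq ?_
    rw [← add_mul, hst, one_mul]

/-- Otherwise the sets for `e = 1 / (n + 1)` are nested, convex and nonempty, and an almost sure
limit of members exists. Its expected excess over `k` is `0`, so it is bounded by `k`, and the Fatou
property keeps it acceptable: it lies in the set assumed empty. -/
theorem IsCashFunctional.exists_next_excess (hρ : IsCashFunctional P ρ) (X : Lp ℝ ∞ P) (c : ℝ)
    (δ : ℕ → ℝ) (k : ℕ) (hδ : excessConstrained P ρ X c δ k = ∅) :
    ∃ e > 0, excessConstrained P ρ X c (Function.update δ k e) (k + 1) = ∅ := by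
  by_contra! hcon
  let C : ℕ → Set (Lp ℝ ∞ P) := fun n =>
    excessConstrained P ρ X c (Function.update δ k (1 / ((n : ℝ) + 1))) (k + 1)
  have hanti : Antitone C := by
    intro a b hab Z hZ
    refine ⟨hZ.1, hZ.2.1, fun j hj => (hZ.2.2 j hj).trans ?_⟩
    by_cases hjk : j = k
    · subst hjk
      rw [Function.update_self, Function.update_self]
      gcongr
    · rw [Function.update_of_ne hjk, Function.update_of_ne hjk]
  have hbound : ∀ n, ∀ Z ∈ C n, ∀ᵐ ω ∂P, 0 ≤ Z ω ∧ Z ω ≤ (k : ℝ) + 1 := by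
    intro n Z hZ
    filter_upwards [Lp.ae_of_le hZ.1.1, Lp.ae_of_le hZ.1.2, Lp.coeFn_zero ℝ ∞ P,
      Lp.const_ae (P := P) ((k + 1 : ℕ) : ℝ)] with ω h1 h2 h3 h4
    rw [h3] at h1
    rw [h4] at h2
    exact ⟨h1, by exact_mod_cast h2⟩
  have habs : ∀ n, ∀ Z ∈ C n, ∀ᵐ ω ∂P, |Z ω| ≤ (k : ℝ) + 1 := by
    intro n Z hZ
    filter_upwards [hbound n Z hZ] with ω h
    rw [abs_of_nonneg h.1]
    exact h.2
  obtain ⟨z, hzC, Z, hzZ⟩ := exists_ae_tendsto_of_antitone_convex C hanti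
    (fun n => hρ.convex_excessConstrained X c _ _) (fun n => hcon _ (by positivity))
    (by positivity : (0 : ℝ) ≤ (k : ℝ) + 1) (habs 0)
  have hzb : ∀ᵐ ω ∂P, ∀ n, 0 ≤ z n ω ∧ z n ω ≤ (k : ℝ) + 1 :=
    ae_all_iff.2 fun n => hbound n _ (hzC n)
  have hex : ∀ j : ℕ, Tendsto (fun n => expectedExcess P (z n) j) atTop
      (𝓝 (expectedExcess P Z j)) := by
    intro j
    refine tendsto_integral_of_dominated_convergence (fun _ => (k : ℝ) + 1)
      (fun n => (integrable_excess (z n) j).1) (integrable_const _) (fun n => ?_) ?_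
    · filter_upwards [hzb] with ω h
      rw [Real.norm_of_nonneg (le_max_right _ _)]
      exact max_le (by linarith [(h n).2, (Nat.cast_nonneg j : (0 : ℝ) ≤ j)]) (by positivity)
    · filter_upwards [hzZ] with ω h
      exact (h.sub_const _).max tendsto_const_nhds
  have hk0 : expectedExcess P Z k ≤ 0 := by
    refine le_of_tendsto_of_tendsto' (hex k) tendsto_one_div_add_atTop_nhds_zero_nat fun n => ?_
    have h := (hzC n).2.2 k (Nat.lt_succ_self k)
    rwa [Function.update_self] at h
  have hmem : Z ∈ excessConstrained P ρ X c δ k := by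
    refine ⟨⟨?_, ?_⟩, ?_, fun j hj => ?_⟩
    · rw [← Lp.coeFn_le]
      filter_upwards [hzb, hzZ, Lp.coeFn_zero ℝ ∞ P] with ω h1 h2 h3
      rw [h3]
      exact ge_of_tendsto h2 (Eventually.of_forall fun n => (h1 n).1)
    · have h0 : (fun ω => max (Z ω - (k : ℝ)) 0) =ᵐ[P] 0 :=
        (integral_eq_zero_iff_of_nonneg (fun ω => le_max_right _ _) (integrable_excess Z k)).1
          (le_antisymm hk0 (integral_nonneg fun ω => le_max_right _ _))
      rw [← Lp.coeFn_le]
      filter_upwards [h0, Lp.const_ae (P := P) (k : ℝ)] with ω h1 h2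
      rw [h2]
      have h3 := le_max_left (Z ω - (k : ℝ)) 0
      simp only [Pi.zero_apply] at h1
      linarith
    · refine hρ.fatou (z := fun n => X - z n) (R := ‖X‖ + ((k : ℝ) + 1)) (fun n => ?_)
        (fun n => (hzC n).2.1) ?_
      · filter_upwards [habs n _ (hzC n), Lp.ae_abs_le_norm X, Lp.coeFn_sub X (z n)] with ω h1 h2 h3
        rw [h3]
        exact (abs_sub _ _).trans (add_le_add h2 h1)
      · filter_upwards [ae_all_iff.2 fun n => Lp.coeFn_sub X (z n), Lp.coeFn_sub X Z, hzZ]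
          with ω h1 h2 h3
        simp only [h1, h2, Pi.sub_apply]
        exact h3.const_sub _
    · refine le_of_tendsto' (hex j) fun n => ?_
      have h := (hzC n).2.2 j (hj.trans (Nat.lt_succ_self k))
      rwa [Function.update_of_ne hj.ne] at h
  rw [hδ] at hmem
  exact hmem

/-- The levels are chosen one at a time, starting from `k = 0`, where only `Z = 0` is allowed and `c
< ρ X` excludes it. -/
theorem IsCashFunctional.exists_excess_levels (hρ : IsCashFunctional P ρ) (X : Lp ℝ ∞ P) {c : ℝ}
    (hc : c < ρ X) : ∃ δ : ℕ → ℝ, (∀ j, 0 < δ j) ∧ ∀ k, excessConstrained P ρ X c δ k = ∅ := by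
  have h0 : ∀ δ, excessConstrained P ρ X c δ 0 = ∅ := by
    intro δ
    ext Z
    simp only [Set.mem_empty_iff_false, iff_false]
    rintro ⟨⟨h1, h2⟩, h3, -⟩
    have : Z = 0 := le_antisymm (by simpa using h2) h1
    rw [this, sub_zero] at h3
    linarith
  choose e he hempty using fun δ k hδ => hρ.exists_next_excess X c δ k hδ
  let D : ∀ k, {δ : ℕ → ℝ // excessConstrained P ρ X c δ k = ∅} := fun k =>
    Nat.rec ⟨fun _ => 1, h0 _⟩
      (fun k δ => ⟨Function.update δ.1 k (e δ.1 k δ.2), hempty δ.1 k δ.2⟩) k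
  have hD : ∀ k, (D (k + 1)).1 = Function.update (D k).1 k (e (D k).1 k (D k).2) := fun k => rfl
  -- Coordinate `j` is set at stage `j + 1` and never changed again, so the diagonal sequence is
  -- well defined and inherits every emptiness.
  have hstab : ∀ k j, j < k → (D k).1 j = (D (j + 1)).1 j := by
    intro k
    induction k with
    | zero => intro j hj; omega
    | succ k ih =>
      intro j hj
      rcases Nat.lt_succ_iff_lt_or_eq.1 hj with h | h
      · rw [hD, Function.update_of_ne h.ne, ih j h]
      · rw [h]
  refine ⟨fun j => (D (j + 1)).1 j, fun j => ?_, fun k => ?_⟩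
  · change 0 < (D (j + 1)).1 j
    rw [hD, Function.update_self]
    exact he _ _ _
  · refine Eq.trans ?_ (D k).2
    ext Z
    refine and_congr Iff.rfl (and_congr Iff.rfl (forall₂_congr fun j hj => ?_))
    rw [hstab k j hj]

end Static

/-! ### Hahn-Banach separation and countably additive dual measures -/

section StaticDual

variable {Ω : Type*} {m : MeasurableSpace Ω} {P : Measure Ω} [IsProbabilityMeasure P]
  {ρ : Lp ℝ ∞ P → ℝ}

/-- Random variables whose expected excesses over the integers are bounded by `δ`. -/
def excessBall (P : Measure Ω) (δ : ℕ → ℝ) : Set (Lp ℝ ∞ P) :=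
  {Z | ∀ j : ℕ, expectedExcess P Z j ≤ δ j}

theorem convex_excessBall (δ : ℕ → ℝ) : Convex ℝ (excessBall P δ) := by
  have : excessBall P δ = ⋂ j : ℕ, {Z | expectedExcess P Z j ≤ δ j} := by
    ext Z; simp [excessBall]
  rw [this]
  exact convex_iInter fun j => convex_expectedExcess_le _ _

/-- Supplies the norm-interior point that Hahn-Banach needs: below `1`, only the level `j = 0` is a
constraint. -/
theorem ball_subset_excessBall {δ : ℕ → ℝ} (hδ : ∀ j, 0 < δ j) :
    Metric.ball (0 : Lp ℝ ∞ P) (min 1 (δ 0)) ⊆ excessBall P δ := by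
  intro Z hZ j
  rw [mem_ball_zero_iff, lt_min_iff] at hZ
  unfold expectedExcess
  have h : ∀ᵐ ω ∂P, max (Z ω - (j : ℝ)) 0 ≤ δ j := by
    filter_upwards [Lp.ae_abs_le_norm Z] with ω h
    have h1 := (le_abs_self (Z ω)).trans h
    refine max_le ?_ (hδ j).le
    rcases Nat.eq_zero_or_pos j with h0 | h0
    · subst h0
      simp only [Nat.cast_zero, sub_zero]
      linarith [hZ.2]
    · have : (1 : ℝ) ≤ j := by exact_mod_cast h0
      linarith [hZ.1, hδ j]
  have h2 := integral_mono_ae (integrable_excess Z j) (integrable_const (δ j)) h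
  simpa using h2

theorem mem_excessBall_of_nonpos {P : Measure Ω} {δ : ℕ → ℝ} (hδ : ∀ j, 0 < δ j) {Z : Lp ℝ ∞ P} (hZ : Z ≤ 0) :
    Z ∈ excessBall P δ := by
  intro j
  have h : (fun ω => max (Z ω - (j : ℝ)) 0) =ᵐ[P] 0 := by
    filter_upwards [Lp.ae_of_le hZ, Lp.coeFn_zero ℝ ∞ P] with ω h1 h2
    rw [h2] at h1
    have h3 : (0 : ℝ) ≤ j := Nat.cast_nonneg j
    simp only [Pi.zero_apply] at h1 ⊢
    exact max_eq_right (by linarith)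
  unfold expectedExcess
  rw [integral_congr_ae h]
  simpa using (hδ j).le

/-- Only the finitely many levels below `R` constrain the sequence, and dominated convergence
handles each. This property makes a functional bounded above on the set countably additive. -/
theorem eventually_mem_excessBall {δ : ℕ → ℝ} (hδ : ∀ j, 0 < δ j) {z : ℕ → Lp ℝ ∞ P} {R : ℝ}
    (hR : ∀ n, ∀ᵐ ω ∂P, |z n ω| ≤ R) (hz : ∀ᵐ ω ∂P, Tendsto (fun n => z n ω) atTop (𝓝 0)) :
    ∀ᶠ n in atTop, z n ∈ excessBall P δ := by
  obtain ⟨J, hJ⟩ := exists_nat_ge R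
  have hlt : ∀ j ∈ Finset.range J, ∀ᶠ n in atTop, expectedExcess P (z n) j ≤ δ j := by
    intro j _
    have ht : Tendsto (fun n => expectedExcess P (z n) j) atTop (𝓝 (∫ _, (0 : ℝ) ∂P)) := by
      refine tendsto_integral_of_dominated_convergence (fun _ => |R|)
        (fun n => (integrable_excess (z n) j).1) (integrable_const _) (fun n => ?_) ?_
      · filter_upwards [hR n] with ω h
        rw [Real.norm_of_nonneg (le_max_right _ _)]
        refine max_le ?_ (abs_nonneg _)
        linarith [le_abs_self (z n ω), le_abs_self R, (Nat.cast_nonneg j : (0 : ℝ) ≤ j)]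
      · filter_upwards [hz] with ω h
        have h1 := (h.sub_const (j : ℝ)).max (tendsto_const_nhds (x := (0 : ℝ)))
        rwa [max_eq_right (by simp)] at h1
    rw [integral_zero] at ht
    filter_upwards [ht.eventually (gt_mem_nhds (hδ j))] with n hn
    exact le_of_lt hn
  filter_upwards [(Finset.eventually_all _).2 hlt] with n hn j
  by_cases hj : j < J
  · exact hn j (Finset.mem_range.2 hj)
  · have hJj : (J : ℝ) ≤ j := by exact_mod_cast not_lt.1 hj
    have h : (fun ω => max (z n ω - (j : ℝ)) 0) =ᵐ[P] 0 := by
      filter_upwards [hR n] with ω h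
      exact max_eq_right (by linarith [le_abs_self (z n ω)])
    unfold expectedExcess
    rw [integral_congr_ae h]
    simpa using (hδ j).le

/-- The separation takes place in the norm topology, but against a convex neighbourhood of `0` large
enough to absorb bounded sequences tending to `0` almost surely; the levels `δ` keep it disjoint
from the acceptable positions. -/
theorem IsCashFunctional.exists_separating_functional (hρ : IsCashFunctional P ρ) (X : Lp ℝ ∞ P)
    {c : ℝ} (hc : c < ρ X) : ∃ (δ : ℕ → ℝ) (f : StrongDual ℝ (Lp ℝ ∞ P)) (u : ℝ),
      (∀ j, 0 < δ j) ∧ f ≠ 0 ∧ (∀ Z ∈ excessBall P δ, f Z ≤ u) ∧ ∀ Z, ρ (X - Z) ≤ c → u ≤ f Z := by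
  obtain ⟨δ, hδ, hempty⟩ := hρ.exists_excess_levels X hc
  have hint : (interior (excessBall P δ)).Nonempty :=
    ⟨0, mem_interior.2 ⟨_, ball_subset_excessBall hδ, Metric.isOpen_ball,
      Metric.mem_ball_self (lt_min one_pos (hδ 0))⟩⟩
  have hdisj : Disjoint (excessBall P δ) {Z | ρ (X - Z) ≤ c} := by
    rw [Set.disjoint_left]
    intro Z hZ hZc
    obtain ⟨k, hk⟩ := exists_nat_ge ‖Z‖
    -- The positive part has the same excesses over the levels `j ≥ 0`, and subtracting it costs no
    -- more than subtracting `Z`.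
    have hmem : Z ⊔ 0 ∈ excessConstrained P ρ X c δ k := by
      refine ⟨⟨le_sup_right, sup_le ?_ ?_⟩,
        (hρ.mono (sub_le_sub_left le_sup_left X)).trans hZc, fun j _ => ?_⟩
      · rw [← Lp.coeFn_le]
        filter_upwards [Lp.ae_abs_le_norm Z, Lp.const_ae (P := P) (k : ℝ)] with ω h1 h2
        rw [h2]
        exact ((le_abs_self _).trans h1).trans hk
      · rw [← Lp.coeFn_le]
        filter_upwards [Lp.coeFn_zero ℝ ∞ P, Lp.const_ae (P := P) (k : ℝ)] with ω h1 h2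
        rw [h1, h2]
        exact Nat.cast_nonneg k
      · refine le_trans (le_of_eq (integral_congr_ae ?_)) (hZ j)
        filter_upwards [Lp.coeFn_sup Z 0, Lp.coeFn_zero ℝ ∞ P] with ω h1 h2
        have h3 : (0 : ℝ) ≤ j := Nat.cast_nonneg j
        simp only [h1, Pi.sup_apply, h2, Pi.zero_apply]
        rcases le_total (Z ω) 0 with h | h
        · rw [sup_eq_right.2 h, max_eq_right (by linarith), max_eq_right (by linarith)]
        · rw [sup_eq_left.2 h]
    rw [hempty k] at hmem
    exact hmem
  have hne : {Z | ρ (X - Z) ≤ c}.Nonempty := by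
    refine ⟨Lp.const ∞ P (ρ X - c), ?_⟩
    have h := hρ.add_const X (c - ρ X)
    have h2 : X - Lp.const ∞ P (ρ X - c) = X + Lp.const ∞ P (c - ρ X) := by
      rw [sub_eq_add_neg, ← map_neg, neg_sub]
    change ρ (X - Lp.const ∞ P (ρ X - c)) ≤ c
    rw [h2, h]
    linarith
  obtain ⟨f, u, hf, h1, h2⟩ := geometric_hahn_banach_of_nonempty_interior (convex_excessBall δ)
    (hρ.convex_acceptable X c) (hdisj.mono_left interior_subset) hint hne
  exact ⟨δ, f, u, hδ, hf, h1, h2⟩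

/-- The separating functional is positive, because the excess set contains all nonpositive
positions, and countably additive, because that set absorbs bounded null sequences. Normalizing it
gives a probability measure. -/
theorem IsCashFunctional.exists_dual_measure (hρ : IsCashFunctional P ρ) (X : Lp ℝ ∞ P)
    {c : ℝ} (hc : c < ρ X) : ∃ Q : Measure Ω, IsProbabilityMeasure Q ∧ Q ≪ P ∧
      ∀ Y : Lp ℝ ∞ P, ∫ ω, Y ω ∂Q + c ≤ ∫ ω, X ω ∂Q + ρ Y := by
  obtain ⟨δ, f, u, hδ, hf0, hfu, huf⟩ := hρ.exists_separating_functional X hc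
  have hu : 0 ≤ u := by
    simpa using hfu 0 (mem_excessBall_of_nonpos hδ le_rfl)
  have hscale : ∀ Z : Lp ℝ ∞ P, (∀ t : ℝ, 0 < t → t • Z ∈ excessBall P δ) → f Z ≤ 0 := by
    intro Z hZ
    by_contra! hpos
    have h := hfu _ (hZ ((u + 1) / f Z) (by positivity))
    rw [map_smul, smul_eq_mul, div_mul_cancel₀ _ hpos.ne'] at h
    linarith
  have hpos : ∀ Z, 0 ≤ Z → 0 ≤ f Z := by
    intro Z hZ
    have h := hscale (-Z) fun t ht => mem_excessBall_of_nonpos hδ (by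
      rw [smul_neg]
      simpa using linfty_smul_le_smul ht.le hZ)
    rw [map_neg] at h
    linarith
  have hupper : ∀ (z : ℕ → Lp ℝ ∞ P) (R : ℝ), (∀ n, ∀ᵐ ω ∂P, |z n ω| ≤ R) →
      (∀ᵐ ω ∂P, Tendsto (fun n => z n ω) atTop (𝓝 0)) → ∀ ε > 0, ∀ᶠ n in atTop, f (z n) < ε := by
    intro z R hR hz ε hε
    -- With this scaling, the bound `u` on the excess set gives `f (z n) ≤ u * ε / (u + 1) < ε`.
    have hm := eventually_mem_excessBall hδ (z := fun n => ((u + 1) / ε) • z n)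
      (R := (u + 1) / ε * R) (fun n => by
        filter_upwards [hR n, Lp.coeFn_smul ((u + 1) / ε) (z n)] with ω h1 h2
        rw [h2, Pi.smul_apply, smul_eq_mul, abs_mul, abs_of_pos (by positivity)]
        gcongr)
      (by
        filter_upwards [hz, ae_all_iff.2 fun n => Lp.coeFn_smul ((u + 1) / ε) (z n)] with ω h1 h2
        simp only [h2, Pi.smul_apply, smul_eq_mul]
        simpa using h1.const_mul ((u + 1) / ε))
    filter_upwards [hm] with n hn
    have h := hfu _ hn
    rw [map_smul, smul_eq_mul, div_mul_eq_mul_div, div_le_iff₀ hε] at h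
    nlinarith
  obtain ⟨ν, hνf, hνP, hν⟩ := exists_measure_of_positive_functional f.toLinearMap hpos
    (fun z R hR hz => by
      rw [Metric.tendsto_atTop']
      intro ε hε
      have h1 := hupper z R hR hz ε hε
      have h2 := hupper (fun n => -z n) R
        (fun n => by
          filter_upwards [hR n, Lp.coeFn_neg (z n)] with ω h1 h2
          rwa [h2, Pi.neg_apply, abs_neg])
        (by
          filter_upwards [hz, ae_all_iff.2 fun n => Lp.coeFn_neg (z n)] with ω h1 h2
          simp only [h2, Pi.neg_apply]
          simpa using h1.neg) ε hε
      obtain ⟨N, hN⟩ := eventually_atTop.1 (h1.and h2)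
      refine ⟨N, fun n hn => ?_⟩
      have h := hN n hn.le
      rw [map_neg] at h
      rw [Real.dist_eq, sub_zero, abs_lt]
      exact ⟨by change -ε < f (z n); linarith [h.2], h.1⟩)
  have hν' : ∀ Y, f Y = ∫ ω, Y ω ∂ν := hν
  have hν0 : ν ≠ 0 := by
    rintro rfl
    exact hf0 (by ext Y; simpa using hν' Y)
  have hmass : 0 < ν.real Set.univ := by
    rw [measureReal_def, ENNReal.toReal_pos_iff]
    exact ⟨Measure.measure_univ_pos.2 hν0, measure_lt_top _ _⟩
  have hνne : NeZero ν := ⟨hν0⟩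
  refine ⟨(ν Set.univ)⁻¹ • ν, inferInstance, Measure.AbsolutelyContinuous.smul_left hνP _, fun Y => ?_⟩
  -- Cash-additivity shifts `Y` to have value exactly `c`, giving a test position for the
  -- separation.
  have hacc : ρ (X - (X - Y - Lp.const ∞ P (c - ρ Y))) ≤ c := by
    have h : X - (X - Y - Lp.const ∞ P (c - ρ Y)) = Y + Lp.const ∞ P (c - ρ Y) := by abel
    rw [h, hρ.add_const]
    linarith
  have hfc : f (Lp.const ∞ P (c - ρ Y)) = ν.real Set.univ * (c - ρ Y) := by
    rw [hν', integral_congr_ae (hνP.ae_le (Lp.const_ae (c - ρ Y))), integral_const, smul_eq_mul]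
  have h := hu.trans (huf _ hacc)
  rw [map_sub, map_sub, hfc, hν', hν'] at h
  rw [integral_smul_measure, integral_smul_measure, ENNReal.toReal_inv, ← measureReal_def,
    smul_eq_mul, smul_eq_mul]
  have h5 : c - ρ Y ≤ (ν.real Set.univ)⁻¹ * (∫ ω, X ω ∂ν - ∫ ω, Y ω ∂ν) := by
    rw [le_inv_mul_iff₀ hmass]
    linarith
  rw [mul_sub] at h5
  linarith

end StaticDual

/-! ### Separation of weak* closed cones from the positive orthant -/

section KrepsYan

variable {Ω : Type*} {m : MeasurableSpace Ω} {P : Measure Ω}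

theorem integrable_linfty_mul_L1 (X : Lp ℝ ∞ P) (g : Lp ℝ 1 P) :
    Integrable (fun ω => X ω * g ω) P :=
  (L1.integrable_coeFn g).bdd_mul (c := ‖X‖) (Lp.stronglyMeasurable X).aestronglyMeasurable
    (Lp.ae_abs_le_norm X)

/-- The duality between `L^∞` and `L^1`. -/
noncomputable def linftyL1Pairing (P : Measure Ω) : Lp ℝ ∞ P →ₗ[ℝ] Lp ℝ 1 P →ₗ[ℝ] ℝ :=
  LinearMap.mk₂ ℝ (fun X g => ∫ ω, X ω * g ω ∂P)
    (fun X Y g => by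
      rw [← integral_add (integrable_linfty_mul_L1 X g) (integrable_linfty_mul_L1 Y g)]
      refine integral_congr_ae ?_
      filter_upwards [Lp.coeFn_add X Y] with ω h
      rw [h, Pi.add_apply, add_mul])
    (fun c X g => by
      rw [smul_eq_mul, ← integral_const_mul]
      refine integral_congr_ae ?_
      filter_upwards [Lp.coeFn_smul c X] with ω h
      rw [h, Pi.smul_apply, smul_eq_mul, mul_assoc])
    (fun X g h => by
      rw [← integral_add (integrable_linfty_mul_L1 X g) (integrable_linfty_mul_L1 X h)]
      refine integral_congr_ae ?_
      filter_upwards [Lp.coeFn_add g h] with ω h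
      rw [h, Pi.add_apply, mul_add])
    (fun c X g => by
      rw [smul_eq_mul, ← integral_const_mul]
      refine integral_congr_ae ?_
      filter_upwards [Lp.coeFn_smul c g] with ω h
      rw [h, Pi.smul_apply, smul_eq_mul, mul_left_comm])

theorem linftyL1Pairing_apply (X : Lp ℝ ∞ P) (g : Lp ℝ 1 P) :
    linftyL1Pairing P X g = ∫ ω, X ω * g ω ∂P := rfl

theorem continuous_linftyL1Pairing (X : Lp ℝ ∞ P) : Continuous (linftyL1Pairing P X) := by
  refine AddMonoidHomClass.continuous_of_bound (linftyL1Pairing P X) ‖X‖ fun g => ?_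
  rw [L1.norm_eq_integral_norm, ← integral_const_mul, linftyL1Pairing_apply]
  refine (norm_integral_le_integral_norm _).trans (integral_mono_ae
    (integrable_linfty_mul_L1 X g).norm ((L1.integrable_coeFn g).norm.const_mul _) ?_)
  filter_upwards [Lp.ae_abs_le_norm X] with ω h
  rw [norm_mul]
  exact mul_le_mul_of_nonneg_right h (norm_nonneg _)

/-- A point outside the weak* closure of a convex cone is strictly separated from the cone by an
integrable function. -/
theorem exists_L1_separating {C : Set (Lp ℝ ∞ P)} (hconv : Convex ℝ C)
    (hcone : ∀ c : ℝ, 0 ≤ c → ∀ X ∈ C, c • X ∈ C) (h0 : (0 : Lp ℝ ∞ P) ∈ C) {Y : Lp ℝ ∞ P}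
    (hY : Y ∉ @closure _ (weakStarTopology P) C) :
    ∃ g : Lp ℝ 1 P, (∀ X ∈ C, ∫ ω, X ω * g ω ∂P ≤ 0) ∧ 0 < ∫ ω, Y ω * g ω ∂P := by
  let B := linftyL1Pairing P
  let C' : Set (WeakBilin B) := C
  have hconv' : Convex ℝ (closure C') := Convex.closure (E := WeakBilin B) hconv
  obtain ⟨f, u, hf, hu⟩ := geometric_hahn_banach_closed_point (E := WeakBilin B)
    (s := closure C') (x := Y) hconv' isClosed_closure hY
  obtain ⟨g, rfl⟩ := LinearMap.dualEmbedding_surjective B f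
  have hg : ∀ X : Lp ℝ ∞ P, (WeakBilin.eval B g) X = ∫ ω, X ω * g ω ∂P := fun X => rfl
  have hC : ∀ X ∈ C, ∫ ω, X ω * g ω ∂P < u := fun X hX =>
    hg X ▸ hf X (subset_closure (s := C') hX)
  have hu0 : 0 < u := by
    have h := hC 0 h0
    change linftyL1Pairing P 0 g < u at h
    simpa using h
  refine ⟨g, fun X hX => ?_, hu0.trans (hg Y ▸ hu)⟩
  by_contra! hpos
  -- This multiple of `X` would pair with `g` to exactly `u`, against the strict bound.
  have h := hC _ (hcone (u / ∫ ω, X ω * g ω ∂P) (by positivity) X hX)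
  change linftyL1Pairing P _ g < u at h
  rw [map_smul, LinearMap.smul_apply, linftyL1Pairing_apply, smul_eq_mul,
    div_mul_cancel₀ _ hpos.ne'] at h
  exact lt_irrefl _ h

theorem nonneg_of_polar [IsFiniteMeasure P] {C : Set (Lp ℝ ∞ P)} (hneg : ∀ X ≤ 0, X ∈ C)
    {g : Lp ℝ 1 P} (hg : ∀ X ∈ C, ∫ ω, X ω * g ω ∂P ≤ 0) : 0 ≤ g := by
  classical
  rw [← Lp.coeFn_nonneg]
  refine ae_nonneg_of_forall_setIntegral_nonneg (L1.integrable_coeFn g) fun A hA _ => ?_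
  have hI : (indicatorConstLp ∞ hA (measure_ne_top P A) (-1 : ℝ) : Lp ℝ ∞ P) =ᵐ[P]
      A.indicator fun _ => -1 := indicatorConstLp_coeFn
  have h := hg (indicatorConstLp ∞ hA (measure_ne_top P A) (-1 : ℝ)) (hneg _ (by
    rw [← Lp.coeFn_le]
    filter_upwards [hI, Lp.coeFn_zero ℝ ∞ P] with ω h1 h2
    rw [h1, h2, Set.indicator_apply]
    split_ifs <;> simp))
  have h2 : ∫ ω, (indicatorConstLp ∞ hA (measure_ne_top P A) (-1 : ℝ) : Lp ℝ ∞ P) ω * g ω ∂P =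
      - ∫ ω in A, g ω ∂P := by
    rw [← integral_indicator hA, ← integral_neg]
    refine integral_congr_ae ?_
    filter_upwards [hI] with ω h1
    rw [h1, Set.indicator_apply, Set.indicator_apply]
    split_ifs <;> simp
  linarith

/-- An element of the polar of a cone with maximal support. -/
theorem exists_maximal_support [IsProbabilityMeasure P] {C : Set (Lp ℝ ∞ P)}
    (hneg : ∀ X ≤ 0, X ∈ C) :
    ∃ g : Lp ℝ 1 P, (∀ X ∈ C, ∫ ω, X ω * g ω ∂P ≤ 0) ∧
      ∀ h : Lp ℝ 1 P, (∀ X ∈ C, ∫ ω, X ω * h ω ∂P ≤ 0) → P {ω | 0 < h ω} ≤ P {ω | 0 < g ω} := by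
  let D : Set (Lp ℝ 1 P) := {g | ∀ X ∈ C, linftyL1Pairing P X g ≤ 0}
  have hD0 : ∀ g ∈ D, 0 ≤ g := fun g hg => nonneg_of_polar hneg hg
  let F : Lp ℝ 1 P → ℝ≥0∞ := fun g => P {ω | 0 < g ω}
  have hne : (F '' D).Nonempty := ⟨F 0, 0, fun X _ => by simp, rfl⟩
  obtain ⟨v, -, hv, hvD⟩ := exists_seq_tendsto_sSup hne (OrderTop.bddAbove _)
  choose g hgD hgv using hvD
  -- The weights make the series converge in `L^1`; as they are positive, the support of the sum
  -- contains that of every `g n`.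
  let a : ℕ → ℝ := fun n => (1 / 2) ^ n / (1 + ‖g n‖)
  have ha : ∀ n, 0 < a n := fun n => by positivity
  have hsum : Summable fun n => a n • g n := by
    refine Summable.of_norm_bounded summable_geometric_two fun n => ?_
    rw [norm_smul, Real.norm_of_nonneg (ha n).le, div_mul_eq_mul_div]
    refine div_le_of_le_mul₀ (by positivity) (by positivity) ?_
    gcongr
    linarith [norm_nonneg (g n)]
  have hpos : ∀ n, 0 ≤ a n • g n := fun n => by
    rw [← Lp.coeFn_nonneg]
    filter_upwards [(Lp.coeFn_nonneg _).2 (hD0 _ (hgD n)), Lp.coeFn_smul (a n) (g n)] with ω h1 h2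
    rw [h2]
    exact mul_nonneg (ha n).le h1
  refine ⟨∑' n, a n • g n, fun X hX => ?_, fun h hh => ?_⟩
  · have hs := (hsum.hasSum.map (linftyL1Pairing P X) (continuous_linftyL1Pairing X))
    refine hasSum_le (fun n => ?_) hs hasSum_zero
    simp only [Function.comp_apply, map_smul, smul_eq_mul]
    exact mul_nonpos_of_nonneg_of_nonpos (ha n).le (hgD n X hX)
  · refine (le_sSup (Set.mem_image_of_mem F (show h ∈ D from hh))).trans (le_of_tendsto' hv fun n => ?_)
    rw [← hgv n]
    refine measure_mono_ae ?_
    have hle : a n • g n ≤ ∑' n, a n • g n := hsum.le_tsum n fun k _ => hpos k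
    filter_upwards [(Lp.coeFn_le _ _).2 hle, Lp.coeFn_smul (a n) (g n)] with ω h1 h2 h3
    rw [h2, Pi.smul_apply, smul_eq_mul] at h1
    exact (mul_pos (ha n) h3).trans_le h1

/-- Take `g` with maximal support. If it vanished on a set of positive measure, the indicator of
that set would lie outside the closure, and a separating `h` would be positive on part of it, so `g
+ h` would have a strictly larger support. -/
theorem exists_polar_pos [IsProbabilityMeasure P] {C : Set (Lp ℝ ∞ P)} (hconv : Convex ℝ C)
    (hcone : ∀ c : ℝ, 0 ≤ c → ∀ X ∈ C, c • X ∈ C) (hneg : ∀ X ≤ 0, X ∈ C)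
    (hNFL : @closure _ (weakStarTopology P) C ∩ {X | 0 ≤ X} = {0}) :
    ∃ g : Lp ℝ 1 P, (∀ X ∈ C, ∫ ω, X ω * g ω ∂P ≤ 0) ∧ ∀ᵐ ω ∂P, 0 < g ω := by
  classical
  obtain ⟨g, hg, hmax⟩ := exists_maximal_support hneg
  refine ⟨g, hg, ?_⟩
  by_contra hcon
  let A : Set Ω := {ω | ¬ 0 < g ω}
  have hA : MeasurableSet A :=
    (measurableSet_lt measurable_const (Lp.stronglyMeasurable g).measurable).compl
  have hPA : P A ≠ 0 := fun h => hcon (ae_iff.2 h)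
  let I : Lp ℝ ∞ P := indicatorConstLp ∞ hA (measure_ne_top P A) (1 : ℝ)
  have hI : I =ᵐ[P] A.indicator fun _ => 1 := indicatorConstLp_top_ae hA
  have hI0 : 0 ≤ I := by
    rw [← Lp.coeFn_nonneg]
    filter_upwards [hI] with ω h1
    rw [h1]
    exact Set.indicator_nonneg (fun _ _ => zero_le_one) ω
  have hIne : I ≠ 0 := by
    intro h
    refine hPA (measure_eq_zero_iff_ae_notMem.2 ?_)
    filter_upwards [hI, (h ▸ Lp.coeFn_zero ℝ ∞ P : I =ᵐ[P] 0)] with ω h1 h2 h3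
    rw [h2, Set.indicator_of_mem h3] at h1
    exact zero_ne_one h1
  have hIcl : I ∉ @closure _ (weakStarTopology P) C := fun h =>
    hIne (by
      have h2 : I ∈ ({0} : Set (Lp ℝ ∞ P)) := hNFL ▸ ⟨h, hI0⟩
      exact h2)
  obtain ⟨h, hh, hpos⟩ := exists_L1_separating hconv hcone (hneg 0 le_rfl) hIcl
  have hh0 := (Lp.coeFn_nonneg _).2 (nonneg_of_polar hneg hh)
  have hg0 := (Lp.coeFn_nonneg _).2 (nonneg_of_polar hneg hg)
  have hgh := hmax (g + h) fun X hX => by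
    have h1 : linftyL1Pairing P X (g + h) ≤ 0 := by
      rw [map_add]
      exact add_nonpos (hg X hX) (hh X hX)
    exact h1
  have hmeas : MeasurableSet {ω | 0 < h ω} :=
    measurableSet_lt measurable_const (Lp.stronglyMeasurable h).measurable
  have hAh : P (A ∩ {ω | 0 < h ω}) ≠ 0 := by
    intro h0
    have h1 : ∫ ω, I ω * h ω ∂P = 0 := by
      refine integral_eq_zero_of_ae ?_
      filter_upwards [hI, hh0, measure_eq_zero_iff_ae_notMem.1 h0] with ω h1 h2 h3
      rw [h1, Set.indicator_apply]
      split_ifs with h4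
      · have h5 : ¬ 0 < h ω := fun h5 => h3 ⟨h4, h5⟩
        rw [Pi.zero_apply] at h2 ⊢
        rw [one_mul]
        exact le_antisymm (not_lt.1 h5) h2
      · simp
    exact hpos.ne' h1
  have hsub : P ({ω | 0 < g ω} ∪ (A ∩ {ω | 0 < h ω})) ≤ P {ω | 0 < (g + h : Lp ℝ 1 P) ω} := by
    refine measure_mono_ae ?_
    filter_upwards [hg0, hh0, Lp.coeFn_add g h] with ω h1 h2 h3 h4
    change 0 < (g + h : Lp ℝ 1 P) ω
    rw [Pi.zero_apply] at h1 h2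
    rw [h3, Pi.add_apply]
    rcases h4 with h4 | h4
    · exact add_pos_of_pos_of_nonneg h4 h2
    · exact add_pos_of_nonneg_of_pos h1 h4.2
  have hdisj : Disjoint {ω | 0 < g ω} (A ∩ {ω | 0 < h ω}) :=
    Set.disjoint_left.2 fun ω h1 h2 => h2.1 h1
  rw [measure_union hdisj (hA.inter hmeas)] at hsub
  exact absurd (hsub.trans hgh) (not_le.2 (ENNReal.lt_add_right (measure_ne_top _ _) hAh))

/-- The Kreps-Yan theorem: a convex cone whose weak* closure meets the positive orthant only in
`0` is polar to an equivalent probability measure. -/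
theorem exists_equivalent_measure_of_closure_inter [IsProbabilityMeasure P] {C : Set (Lp ℝ ∞ P)}
    (hconv : Convex ℝ C) (hcone : ∀ c : ℝ, 0 ≤ c → ∀ X ∈ C, c • X ∈ C) (hneg : ∀ X ≤ 0, X ∈ C)
    (hNFL : @closure _ (weakStarTopology P) C ∩ {X | 0 ≤ X} = {0}) :
    ∃ Q : Measure Ω, IsProbabilityMeasure Q ∧ Q ≪ P ∧ P ≪ Q ∧ ∀ X ∈ C, ∫ ω, X ω ∂Q ≤ 0 := by
  obtain ⟨g, hg, hpos⟩ := exists_polar_pos hconv hcone hneg hNFL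
  have hgi := L1.integrable_coeFn g
  let c : ℝ := ∫ ω, g ω ∂P
  have hc : 0 < c := by
    refine lt_of_le_of_ne (integral_nonneg_of_ae (hpos.mono fun ω h => h.le)) fun h0 => ?_
    have h1 := (integral_eq_zero_iff_of_nonneg_ae (hpos.mono fun ω h => h.le) hgi).1 h0.symm
    obtain ⟨ω, h2, h3⟩ := (h1.and hpos).exists
    rw [h2] at h3
    exact lt_irrefl _ h3
  have hm : Measurable fun ω => ENNReal.ofReal (g ω / c) :=
    ((Lp.stronglyMeasurable g).measurable.div_const c).ennreal_ofReal
  have hnn : 0 ≤ᵐ[P] fun ω => g ω / c := hpos.mono fun ω h => div_nonneg h.le hc.le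
  refine ⟨P.withDensity fun ω => ENNReal.ofReal (g ω / c), ⟨?_⟩,
    withDensity_absolutelyContinuous _ _, ?_, fun X hX => ?_⟩
  · rw [withDensity_apply _ MeasurableSet.univ, Measure.restrict_univ,
      ← ofReal_integral_eq_lintegral_ofReal (hgi.div_const c) hnn, integral_div, div_self hc.ne',
      ENNReal.ofReal_one]
  · refine withDensity_absolutelyContinuous' hm.aemeasurable (hpos.mono fun ω h => ?_)
    simp only [ne_eq, ENNReal.ofReal_eq_zero, not_le]
    positivity
  · rw [integral_withDensity_eq_integral_toReal_smul hm (ae_of_all _ fun ω => ENNReal.ofReal_lt_top)]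
    have h : (fun ω => (ENNReal.ofReal (g ω / c)).toReal • X ω) =ᵐ[P]
        fun ω => X ω * g ω / c := by
      filter_upwards [hnn] with ω h
      rw [ENNReal.toReal_ofReal h, smul_eq_mul]
      ring
    rw [integral_congr_ae h, integral_div]
    exact div_nonpos_of_nonpos_of_nonneg (hg X hX) hc.le

end KrepsYan

/-! ### Upwards directed families and pasting of measures -/

section Directed

variable {Ω : Type*} {m' m : MeasurableSpace Ω}

theorem lintegral_ofReal_sub {Q : Measure Ω} {f g : Ω → ℝ} (hf : Integrable f Q)
    (hg : Integrable g Q) (h : g ≤ᵐ[Q] f) :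
    ∫⁻ ω, ENNReal.ofReal (f ω - g ω) ∂Q = ENNReal.ofReal (∫ ω, f ω ∂Q - ∫ ω, g ω ∂Q) := by
  rw [← integral_sub hf hg]
  exact (ofReal_integral_eq_lintegral_ofReal (hf.sub hg)
    (h.mono fun ω h => sub_nonneg.2 h)).symm

/-- A countable majorant of an upwards directed family, relative to a member with almost maximal
integral. -/
theorem exists_majorant_of_directed {Q : Measure Ω} (hm : m' ≤ m)
    {𝒲 : Set (Ω → ℝ)} (hint : ∀ f ∈ 𝒲, Integrable f Q) (hmeas : ∀ f ∈ 𝒲, StronglyMeasurable[m'] f)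
    (hdir : ∀ f ∈ 𝒲, ∀ g ∈ 𝒲, ∃ h ∈ 𝒲, f ≤ᵐ[Q] h ∧ g ≤ᵐ[Q] h) {w : Ω → ℝ} (hw : w ∈ 𝒲) {ε : ℝ}
    (hε : ∀ f ∈ 𝒲, ∫ ω, f ω ∂Q ≤ ∫ ω, w ω ∂Q + ε) :
    ∃ G : Ω → ℝ≥0∞, Measurable[m'] G ∧ ∫⁻ ω, G ω ∂Q ≤ ENNReal.ofReal ε ∧
      ∀ f ∈ 𝒲, ∀ᵐ ω ∂Q, ENNReal.ofReal (f ω - w ω) ≤ G ω := by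
  let s : ℝ := sSup ((fun f => ∫ ω, f ω ∂Q) '' 𝒲)
  have hbdd : BddAbove ((fun f => ∫ ω, f ω ∂Q) '' 𝒲) :=
    ⟨∫ ω, w ω ∂Q + ε, by rintro _ ⟨f, hf, rfl⟩; exact hε f hf⟩
  have hs : ∀ f ∈ 𝒲, ∫ ω, f ω ∂Q ≤ s := fun f hf => le_csSup hbdd ⟨f, hf, rfl⟩
  have hv : ∀ n : ℕ, ∃ v : 𝒲, s - 1 / ((n : ℝ) + 1) < ∫ ω, v.1 ω ∂Q := by
    intro n
    obtain ⟨_, ⟨v, hv, rfl⟩, h⟩ := exists_lt_of_lt_csSup (Set.Nonempty.image _ ⟨w, hw⟩)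
      (show s - 1 / ((n : ℝ) + 1) < s from sub_lt_self _ (by positivity))
    exact ⟨⟨v, hv⟩, h⟩
  choose v hv using hv
  have hdir' : ∀ f g : 𝒲, ∃ h : 𝒲, f.1 ≤ᵐ[Q] h.1 ∧ g.1 ≤ᵐ[Q] h.1 := fun f g =>
    let ⟨h, hh, h1⟩ := hdir f.1 f.2 g.1 g.2
    ⟨⟨h, hh⟩, h1⟩
  choose j hj1 hj2 using hdir'
  let h : ℕ → 𝒲 := fun n => Nat.rec (j ⟨w, hw⟩ (v 0)) (fun n h => j h (v (n + 1))) n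
  have hsucc : ∀ n, h (n + 1) = j (h n) (v (n + 1)) := fun n => rfl
  have hmono : ∀ n, (h n).1 ≤ᵐ[Q] (h (n + 1)).1 := fun n => hj1 _ _
  have hvh : ∀ n, (v n).1 ≤ᵐ[Q] (h n).1 := by
    intro n
    cases n with
    | zero => exact hj2 _ _
    | succ n => exact hj2 _ _
  have hwh : ∀ n, w ≤ᵐ[Q] (h n).1 := by
    intro n
    induction n with
    | zero => exact hj1 ⟨w, hw⟩ _
    | succ n ih => exact ih.trans (hmono n)
  have hm1 : ∀ f ∈ 𝒲, Measurable[m'] fun ω => ENNReal.ofReal (f ω - w ω) := fun f hf =>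
    ((hmeas f hf).measurable.sub (hmeas w hw).measurable).ennreal_ofReal
  refine ⟨fun ω => ⨆ n, ENNReal.ofReal ((h n).1 ω - w ω),
    Measurable.iSup fun n => hm1 _ (h n).2, ?_, fun f hf => ?_⟩
  · rw [lintegral_iSup_ae (fun n => (hm1 _ (h n).2).mono hm le_rfl) fun n => by
      filter_upwards [hmono n] with ω h1
      exact ENNReal.ofReal_le_ofReal (sub_le_sub_right h1 _)]
    refine iSup_le fun n => ?_
    rw [lintegral_ofReal_sub (hint _ (h n).2) (hint _ hw) (hwh n)]
    refine ENNReal.ofReal_le_ofReal ?_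
    linarith [hε _ (h n).2]
  -- A common majorant of `f` and `h n` has integral at most the supremum `s`, while `h n` comes
  -- within `1 / (n + 1)` of it.
  · have hgap : ∀ n : ℕ, ∫⁻ ω, ENNReal.ofReal (f ω - (h n).1 ω) ∂Q ≤
        ENNReal.ofReal (1 / ((n : ℝ) + 1)) := by
      intro n
      have h1 : ∫⁻ ω, ENNReal.ofReal (f ω - (h n).1 ω) ∂Q ≤
          ∫⁻ ω, ENNReal.ofReal ((j ⟨f, hf⟩ (h n)).1 ω - (h n).1 ω) ∂Q := by
        refine lintegral_mono_ae ?_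
        filter_upwards [hj1 ⟨f, hf⟩ (h n)] with ω h1
        exact ENNReal.ofReal_le_ofReal (sub_le_sub_right h1 _)
      refine h1.trans ?_
      rw [lintegral_ofReal_sub (hint _ (j ⟨f, hf⟩ (h n)).2) (hint _ (h n).2) (hj2 _ _)]
      refine ENNReal.ofReal_le_ofReal ?_
      have h2 := integral_mono_ae (hint _ (v n).2) (hint _ (h n).2) (hvh n)
      linarith [hs _ (j ⟨f, hf⟩ (h n)).2, hv n]
    have hzero : ∫⁻ ω, (ENNReal.ofReal (f ω - w ω) -
        ⨆ n, ENNReal.ofReal ((h n).1 ω - w ω)) ∂Q = 0 := by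
      refine le_antisymm (ge_of_tendsto' (f := fun n : ℕ => ENNReal.ofReal (1 / ((n : ℝ) + 1)))
        (x := atTop) ?_ fun n => ?_) zero_le
      · have h1 := ENNReal.tendsto_ofReal (tendsto_one_div_add_atTop_nhds_zero_nat (𝕜 := ℝ))
        rwa [ENNReal.ofReal_zero] at h1
      · refine (lintegral_mono fun ω => ?_).trans (hgap n)
        rw [tsub_le_iff_right]
        calc ENNReal.ofReal (f ω - w ω)
            = ENNReal.ofReal ((f ω - (h n).1 ω) + ((h n).1 ω - w ω)) := by ring_nf
          _ ≤ _ := ENNReal.ofReal_add_le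
          _ ≤ _ := add_le_add le_rfl (le_iSup (fun n => ENNReal.ofReal ((h n).1 ω - w ω)) n)
    have hmG : Measurable fun ω => ENNReal.ofReal (f ω - w ω) -
        ⨆ n, ENNReal.ofReal ((h n).1 ω - w ω) :=
      ((hm1 f hf).mono hm le_rfl).sub
        (Measurable.iSup fun n => (hm1 _ (h n).2).mono hm le_rfl)
    filter_upwards [(lintegral_eq_zero_iff hmG).1 hzero] with ω h1
    exact tsub_eq_zero_iff_le.1 h1

theorem trim_eq_of_forall_eq {Q R : Measure Ω} (hm : m' ≤ m)
    (h : ∀ A, MeasurableSet[m'] A → Q A = R A) : Q.trim hm = R.trim hm := by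
  refine @Measure.ext _ m' _ _ fun A hA => ?_
  rw [trim_measurableSet_eq hm hA, trim_measurableSet_eq hm hA, h A hA]

/-- The measure that agrees with `R` on `m'` and has the conditional law of `Q` given `m'`. -/
theorem exists_pasted_measure {P Q R : Measure Ω} [IsProbabilityMeasure Q] [IsProbabilityMeasure R]
    (hm : m' ≤ m) (hQP : Q ≪ P) (hRQ : R ≪ Q) (hQR : Q ≪ R) :
    ∃ Q' : Measure Ω, IsProbabilityMeasure Q' ∧
      Q' ≪ Q ∧ Q ≪ Q' ∧ (∀ A, MeasurableSet[m'] A → Q' A = R A) ∧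
      ∀ W : Lp ℝ ∞ P, (∀ A, MeasurableSet[m'] A → ∫ ω in A, W ω ∂Q ≤ 0) → ∫ ω, W ω ∂Q' ≤ 0 := by
  -- The density of the restrictions to `m'` is `m'`-measurable, so it can be pulled out of
  -- conditional expectations given `m'`.
  let d : Ω → ℝ≥0∞ := (R.trim hm).rnDeriv (Q.trim hm)
  have hd' : Measurable[m'] d := Measure.measurable_rnDeriv _ _
  have hd : Measurable d := hd'.mono hm le_rfl
  have hfin : ∀ᵐ ω ∂Q, d ω < ∞ :=
    ae_of_ae_trim hm ((R.trim hm).rnDeriv_lt_top (Q.trim hm))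
  have hpos : ∀ᵐ ω ∂Q, 0 < d ω :=
    ae_of_ae_trim hm (Measure.rnDeriv_pos' (hQR.trim hm))
  have happ : ∀ A, MeasurableSet[m'] A → Q.withDensity d A = R A := by
    intro A hA
    rw [withDensity_apply _ (hm A hA), ← trim_measurableSet_eq hm hA,
      ← Measure.setLIntegral_rnDeriv (hRQ.trim hm), ← lintegral_trim hm hd', restrict_trim hm _ hA]
  have hprob : IsProbabilityMeasure (Q.withDensity d) :=
    ⟨by rw [happ _ MeasurableSet.univ, measure_univ]⟩
  refine ⟨Q.withDensity d, hprob, withDensity_absolutelyContinuous _ _,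
    withDensity_absolutelyContinuous' hd.aemeasurable (hpos.mono fun ω h => h.ne'), happ,
    fun W hW => ?_⟩
  have hWi : Integrable W Q := integrable_linfty hQP W
  have hdi : Integrable (fun ω => (d ω).toReal) Q := by
    refine integrable_toReal_of_lintegral_ne_top hd.aemeasurable ?_
    have h := happ _ MeasurableSet.univ
    rw [withDensity_apply _ MeasurableSet.univ, Measure.restrict_univ] at h
    rw [h]
    exact measure_ne_top _ _
  have hdW : Integrable ((fun ω => (d ω).toReal) * (W : Ω → ℝ)) Q :=
    hdi.mul_bdd (c := ‖W‖) (Lp.stronglyMeasurable W).aestronglyMeasurable 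
      (hQP.ae_le (Lp.ae_abs_le_norm W))
  have hneg : Q[(W : Ω → ℝ) | m'] ≤ᵐ[Q] 0 := by
    let A : Set Ω := {ω | 0 < Q[(W : Ω → ℝ) | m'] ω}
    have hA : MeasurableSet[m'] A :=
      measurableSet_lt measurable_const stronglyMeasurable_condExp.measurable
    have h1 := hW A hA
    rw [← setIntegral_condExp hm hWi hA] at h1
    have h2 : 0 ≤ᵐ[Q.restrict A] Q[(W : Ω → ℝ) | m'] := by
      filter_upwards [ae_restrict_mem (hm A hA)] with ω h
      exact le_of_lt h
    have h3 := (integral_eq_zero_iff_of_nonneg_ae h2 integrable_condExp.integrableOn).1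
      (le_antisymm h1 (integral_nonneg_of_ae h2))
    rw [Filter.EventuallyEq, ae_restrict_iff' (hm A hA)] at h3
    filter_upwards [h3] with ω h4
    by_contra h5
    have h6 : ω ∈ A := not_le.1 h5
    exact h5 (h4 h6).le
  have h1 := condExp_mul_of_stronglyMeasurable_left (m := m') (μ := Q)
    hd'.ennreal_toReal.stronglyMeasurable hdW hWi
  rw [integral_withDensity_eq_integral_toReal_smul hd hfin]
  calc ∫ ω, (d ω).toReal • W ω ∂Q
      = ∫ ω, Q[(fun ω => (d ω).toReal) * (W : Ω → ℝ) | m'] ω ∂Q := (integral_condExp hm).symm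
    _ = ∫ ω, (d ω).toReal * Q[(W : Ω → ℝ) | m'] ω ∂Q := integral_congr_ae h1
    _ ≤ 0 := integral_nonpos_of_ae (by
        filter_upwards [hneg] with ω h
        exact mul_nonpos_of_nonneg_of_nonpos ENNReal.toReal_nonneg h)

end Directed

/-! ### Pricing procedures and costless positions -/

section Dynamics

variable {Ω : Type*} {m : MeasurableSpace Ω} {P : Measure Ω} {𝓕 : Filtration ℝ≥0 m}
  {Pi : PricingMaps P 𝓕}

theorem mem_LInfty_iff {τ : StopTime 𝓕} {X : Lp ℝ ∞ P} :
    X ∈ LInfty P τ ↔ AEStronglyMeasurable[τ.2.measurableSpace] X P :=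
  mem_lpMeas_iff_aestronglyMeasurable

theorem LInfty_mono {σ τ : StopTime 𝓕} (h : σ ≤ τ) : LInfty P σ ≤ LInfty P τ := fun _ hX =>
  mem_LInfty_iff.2 ((mem_LInfty_iff.1 hX).mono (IsStoppingTime.measurableSpace_mono _ _ h))

theorem mem_LInfty_infty (h𝓕 : IsPricingBasis P 𝓕) (X : Lp ℝ ∞ P) :
    X ∈ LInfty P (StopTime.infty 𝓕) := by
  refine mem_LInfty_iff.2 ((Lp.stronglyMeasurable X).aestronglyMeasurable.mono fun s hs => ⟨?_, ?_⟩)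
  · rwa [h𝓕.iSup_eq]
  · intro i
    have : s ∩ {ω | (StopTime.infty 𝓕).1 ω ≤ (i : WithTop ℝ≥0)} = ∅ := by
      ext ω
      simp only [Set.mem_inter_iff, Set.mem_ofPred_eq, Set.mem_empty_iff_false, iff_false, not_and]
      exact fun _ h => WithTop.coe_ne_top (top_le_iff.1 h)
    rw [this]
    exact @MeasurableSet.empty _ (𝓕 i)

theorem StopTime.le_infty (τ : StopTime 𝓕) : τ ≤ StopTime.infty 𝓕 := fun _ => le_top

theorem StopTime.zero_le (τ : StopTime 𝓕) : StopTime.zero 𝓕 ≤ τ := fun ω => by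
  change ((0 : ℝ≥0) : WithTop ℝ≥0) ≤ τ.1 ω
  exact bot_le

theorem indicatorConstLp_mem_LInfty [IsFiniteMeasure P] {σ : StopTime 𝓕} {A : Set Ω}
    (hA : MeasurableSet[σ.2.measurableSpace] A) (c : ℝ) :
    (indicatorConstLp ∞ (σ.2.measurableSpace_le A hA) (measure_ne_top P A) c : Lp ℝ ∞ P) ∈
      LInfty P σ :=
  mem_LInfty_iff.2 (AEStronglyMeasurable.congr
    ((stronglyMeasurable_const.indicator hA).aestronglyMeasurable) indicatorConstLp_coeFn.symm)

theorem aestronglyMeasurable_indicator_of_mem_LInfty {τ : StopTime 𝓕} {X : Lp ℝ ∞ P}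
    (hX : X ∈ LInfty P τ) {A : Set Ω} (hA : MeasurableSet[τ.2.measurableSpace] A) :
    AEStronglyMeasurable[τ.2.measurableSpace] (A.indicator X) P := by
  obtain ⟨g, hg, hXg⟩ := mem_LInfty_iff.1 hX
  refine ⟨A.indicator g, hg.indicator hA, ?_⟩
  filter_upwards [hXg] with ω h
  simp only [Set.indicator, h]

/-- Positions settled at `τ` whose price at `σ` vanishes. -/
def costless (Pi : PricingMaps P 𝓕) (σ τ : StopTime 𝓕) : Set (Lp ℝ ∞ P) :=
  {W | W ∈ LInfty P τ ∧ Pi σ τ W = 0}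

namespace IsDynamicPricingProcedure

variable {σ τ : StopTime 𝓕}

theorem sub_mem_costless (hPi : IsDynamicPricingProcedure P 𝓕 Pi) (h : σ ≤ τ) {X : Lp ℝ ∞ P}
    (hX : X ∈ LInfty P τ) : X - Pi σ τ X ∈ costless Pi σ τ := by
  have h1 := hPi.mapsTo σ τ h X hX
  refine ⟨sub_mem hX (LInfty_mono h h1), ?_⟩
  rw [sub_eq_add_neg, hPi.translation σ τ h _ (neg_mem h1) X hX, add_neg_cancel]

theorem zero_mem_costless (hPi : IsDynamicPricingProcedure P 𝓕 Pi) (h : σ ≤ τ) :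
    (0 : Lp ℝ ∞ P) ∈ costless Pi σ τ := ⟨zero_mem _, hPi.normalized σ τ h⟩

theorem price_eq_self (hPi : IsDynamicPricingProcedure P 𝓕 Pi) (h : σ ≤ τ) {X : Lp ℝ ∞ P}
    (hX : X ∈ LInfty P σ) : Pi σ τ X = X := by
  have h1 := hPi.translation σ τ h X hX 0 (zero_mem _)
  rwa [zero_add, hPi.normalized σ τ h, zero_add] at h1

/-- Costless positions can be glued along events known at the initial time. -/
theorem exists_glued_costless [IsProbabilityMeasure P] (hPi : IsDynamicPricingProcedure P 𝓕 Pi)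
    (h : σ ≤ τ) {W₁ W₂ : Lp ℝ ∞ P} (h₁ : W₁ ∈ costless Pi σ τ) (h₂ : W₂ ∈ costless Pi σ τ)
    {A : Set Ω} (hA : MeasurableSet[σ.2.measurableSpace] A) :
    ∃ W ∈ costless Pi σ τ, W =ᵐ[P] A.indicator W₁ + Aᶜ.indicator W₂ := by
  classical
  have hAm := σ.2.measurableSpace_le A hA
  have hle := IsStoppingTime.measurableSpace_mono σ.2 τ.2 h
  have hmeas : AEStronglyMeasurable[τ.2.measurableSpace] (A.indicator W₁ + Aᶜ.indicator W₂) P :=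
    (aestronglyMeasurable_indicator_of_mem_LInfty h₁.1 (hle _ hA)).add
      (aestronglyMeasurable_indicator_of_mem_LInfty h₂.1 (hle _ hA.compl))
  let M : ℝ := ‖W₁‖ + ‖W₂‖
  have hpt : ∀ ω, (A.indicator W₁ + Aᶜ.indicator W₂ : Ω → ℝ) ω = if ω ∈ A then W₁ ω else W₂ ω := by
    intro ω
    by_cases h : ω ∈ A <;> simp [h]
  obtain ⟨W, hW⟩ := exists_Lp_top_of_bound (P := P) (hmeas.mono τ.2.measurableSpace_le) (C := M) (by
    filter_upwards [Lp.ae_abs_le_norm W₁, Lp.ae_abs_le_norm W₂] with ω h1 h2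
    rw [hpt]
    split_ifs
    · exact h1.trans (le_add_of_nonneg_right (norm_nonneg _))
    · exact h2.trans (le_add_of_nonneg_left (norm_nonneg _)))
  have hWmem : W ∈ LInfty P τ := mem_LInfty_iff.2 (hmeas.congr hW.symm)
  refine ⟨W, ⟨hWmem, ?_⟩, hW⟩
  let I : ∀ B : Set Ω, MeasurableSet[σ.2.measurableSpace] B → ℝ → Lp ℝ ∞ P := fun B hB c =>
    indicatorConstLp ∞ (σ.2.measurableSpace_le B hB) (measure_ne_top P B) c
  have hI : ∀ B hB c, I B hB c =ᵐ[P] B.indicator fun _ => c := fun B hB c => indicatorConstLp_coeFn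
  have hprice : ∀ V ∈ costless Pi σ τ, ∀ B hB c, Pi σ τ (V + I B hB c) = I B hB c := by
    intro V hV B hB c
    rw [hPi.translation σ τ h _ (indicatorConstLp_mem_LInfty hB c) V hV.1, hV.2, zero_add]
  have hmem : ∀ V ∈ costless Pi σ τ, ∀ B hB c, V + I B hB c ∈ LInfty P τ := fun V hV B hB c =>
    add_mem hV.1 (LInfty_mono h (indicatorConstLp_mem_LInfty hB c))
  -- Where `W` agrees with `V` off `B`, a multiple of `1_B` absorbs the difference. As `B` is known
  -- at `σ`, translation invariance prices that correction, so the price of `W` is nonpositive off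
  -- `B`; `hlb` is the mirror bound.
  have hub : ∀ V ∈ costless Pi σ τ, ∀ B hB, (∀ᵐ ω ∂P, W ω ≤ V ω + B.indicator (fun _ => 2 * M) ω) →
      Pi σ τ W ≤ I B hB (2 * M) := by
    intro V hV B hB hle
    rw [← hprice V hV B hB]
    refine hPi.monotone σ τ h _ hWmem _ (hmem V hV B hB _) ?_
    rw [← Lp.coeFn_le]
    filter_upwards [hle, hI B hB (2 * M), Lp.coeFn_add V (I B hB (2 * M))] with ω h1 h2 h3
    rwa [h3, _root_.Pi.add_apply, h2]
  have hlb : ∀ V ∈ costless Pi σ τ, ∀ B hB,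
      (∀ᵐ ω ∂P, V ω + B.indicator (fun _ => -(2 * M)) ω ≤ W ω) →
      I B hB (-(2 * M)) ≤ Pi σ τ W := by
    intro V hV B hB hle
    rw [← hprice V hV B hB]
    refine hPi.monotone σ τ h _ (hmem V hV B hB _) _ hWmem ?_
    rw [← Lp.coeFn_le]
    filter_upwards [hle, hI B hB (-(2 * M)), Lp.coeFn_add V (I B hB (-(2 * M)))] with ω h1 h2 h3
    rwa [h3, _root_.Pi.add_apply, h2]
  have hbd : ∀ᵐ ω ∂P, |W₁ ω - W₂ ω| ≤ 2 * M ∧ W ω = if ω ∈ A then W₁ ω else W₂ ω := by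
    filter_upwards [Lp.ae_abs_le_norm W₁, Lp.ae_abs_le_norm W₂, hW] with ω h1 h2 h3
    refine ⟨(abs_sub _ _).trans ?_, h3.trans (hpt ω)⟩
    have := norm_nonneg W₁
    have := norm_nonneg W₂
    change |W₁ ω| + |W₂ ω| ≤ 2 * (‖W₁‖ + ‖W₂‖)
    linarith
  have u1 := hub W₁ h₁ Aᶜ hA.compl (by
    filter_upwards [hbd] with ω h1
    rw [h1.2]
    have := (abs_le.1 h1.1)
    by_cases hω : ω ∈ A <;> simp [hω]; linarith)
  have u2 := hub W₂ h₂ A hA (by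
    filter_upwards [hbd] with ω h1
    rw [h1.2]
    have := (abs_le.1 h1.1)
    by_cases hω : ω ∈ A <;> simp [hω]; linarith)
  have l1 := hlb W₁ h₁ Aᶜ hA.compl (by
    filter_upwards [hbd] with ω h1
    rw [h1.2]
    have := (abs_le.1 h1.1)
    by_cases hω : ω ∈ A <;> simp [hω]; linarith)
  have l2 := hlb W₂ h₂ A hA (by
    filter_upwards [hbd] with ω h1
    rw [h1.2]
    have := (abs_le.1 h1.1)
    by_cases hω : ω ∈ A <;> simp [hω]; linarith)
  apply Lp.ext
  filter_upwards [Lp.ae_of_le u1, Lp.ae_of_le u2, Lp.ae_of_le l1, Lp.ae_of_le l2,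
    hI A hA (2 * M), hI A hA (-(2 * M)), hI Aᶜ hA.compl (2 * M), hI Aᶜ hA.compl (-(2 * M)),
    Lp.coeFn_zero ℝ ∞ P] with ω a1 a2 a3 a4 b1 b2 b3 b4 b5
  rw [b5, _root_.Pi.zero_apply]
  rw [b3] at a1
  rw [b1] at a2
  rw [b4] at a3
  rw [b2] at a4
  by_cases hω : ω ∈ A
  · simp only [Set.mem_compl_iff, hω, not_true_eq_false, not_false_eq_true,
      Set.indicator_of_notMem] at a1 a3
    exact le_antisymm a1 a3
  · simp only [hω, not_false_eq_true, Set.indicator_of_notMem] at a2 a4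
    exact le_antisymm a2 a4

theorem exists_indicator_costless [IsProbabilityMeasure P]
    (hPi : IsDynamicPricingProcedure P 𝓕 Pi) (h : σ ≤ τ) {V : Lp ℝ ∞ P} (hV : V ∈ costless Pi σ τ)
    {A : Set Ω} (hA : MeasurableSet[σ.2.measurableSpace] A) :
    ∃ W ∈ costless Pi σ τ, W =ᵐ[P] A.indicator V := by
  obtain ⟨W, hW, hWA⟩ := hPi.exists_glued_costless h hV (hPi.zero_mem_costless h) hA
  refine ⟨W, hW, ?_⟩
  filter_upwards [hWA] with ω h1
  rw [h1, _root_.Pi.add_apply]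
  by_cases hω : ω ∈ A <;> simp [hω]

end IsDynamicPricingProcedure

namespace IsTCPP

variable {ν σ τ : StopTime 𝓕}

theorem price_infty_eq (hPi : IsTCPP P 𝓕 Pi) (h : σ ≤ τ) {X : Lp ℝ ∞ P} (hX : X ∈ LInfty P τ) :
    Pi σ (StopTime.infty 𝓕) X = Pi σ τ X := by
  rw [← hPi.timeConsistent σ τ _ h τ.le_infty X (LInfty_mono τ.le_infty hX),
    hPi.pricing.price_eq_self τ.le_infty hX]

/-- Time-consistency prices `W` through its value `0` at `σ`. Bounds at the earliest date thereby
control all later trades. -/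
theorem costless_subset (hPi : IsTCPP P 𝓕 Pi) (h : ν ≤ σ) (h' : σ ≤ τ) :
    costless Pi σ τ ⊆ costless Pi ν (StopTime.infty 𝓕) := by
  intro W hW
  have hW' := LInfty_mono τ.le_infty hW.1
  refine ⟨hW', ?_⟩
  rw [← hPi.timeConsistent ν σ _ h σ.le_infty W hW', hPi.price_infty_eq h' hW.1, hW.2,
    hPi.pricing.normalized ν σ h]

theorem isCashFunctional [IsProbabilityMeasure P] (h𝓕 : IsPricingBasis P 𝓕) (hPi : IsTCPP P 𝓕 Pi)
    (σ : StopTime 𝓕) {μ : Measure Ω} [IsProbabilityMeasure μ] (hμ : μ ≪ P) :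
    IsCashFunctional P fun X => ∫ ω, Pi σ (StopTime.infty 𝓕) X ω ∂μ := by
  have hm := mem_LInfty_infty h𝓕
  have hσ := σ.le_infty
  refine ⟨fun X Y hXY => integral_mono_of_linfty_le hμ
    (hPi.pricing.monotone σ _ hσ X (hm X) Y (hm Y) hXY), ⟨convex_univ, ?_⟩, ?_, ?_⟩
  · intro X _ Y _ s t hs ht hst
    have h := hPi.pricing.convex σ _ hσ X (hm X) Y (hm Y) s hs (by linarith)
    rw [show 1 - s = t by linarith] at h
    refine (integral_mono_of_linfty_le hμ h).trans_eq ?_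
    rw [integral_linfty_add hμ, integral_linfty_smul hμ, integral_linfty_smul hμ]
    rfl
  · intro X c
    have hc : Lp.const ∞ P c ∈ LInfty P σ :=
      mem_LInfty_iff.2 (AEStronglyMeasurable.congr aestronglyMeasurable_const
        (Lp.const_ae c).symm)
    rw [hPi.pricing.translation σ _ hσ _ hc X (hm X), integral_linfty_add hμ,
      integral_congr_ae (hμ.ae_le (Lp.const_ae c)), integral_const]
    simp
  · intro X hX Y hXY
    have h := hPi.continuousFromBelow σ _ hσ X (fun n => hm _) hX Y (hm Y) hXY
    have hmono : ∀ ⦃i j⦄, i ≤ j → Pi σ (StopTime.infty 𝓕) (X i) ≤ Pi σ (StopTime.infty 𝓕) (X j) :=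
      fun i j hij => hPi.pricing.monotone σ _ hσ _ (hm _) _ (hm _) (hX hij)
    have hmono' : ∀ᵐ ω ∂P, Monotone fun n => Pi σ (StopTime.infty 𝓕) (X n) ω := by
      have h2 : ∀ᵐ ω ∂P, ∀ n, Pi σ (StopTime.infty 𝓕) (X n) ω ≤
          Pi σ (StopTime.infty 𝓕) (X (n + 1)) ω :=
        ae_all_iff.2 fun n => Lp.ae_of_le (hmono (Nat.le_succ n))
      filter_upwards [h2] with ω h3
      exact monotone_nat_of_le_succ h3
    exact integral_tendsto_of_tendsto_of_monotone (fun n => integrable_linfty hμ _)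
      (integrable_linfty hμ _) (hμ.ae_le hmono') (hμ.ae_le h)

/-- Convexity and normalization make the claims with nonpositive price generate a convex cone
containing all nonpositive claims, so the Kreps-Yan theorem applies. -/
theorem exists_equivalent_measure [IsProbabilityMeasure P] (h𝓕 : IsPricingBasis P 𝓕)
    (hPi : IsTCPP P 𝓕 Pi) (hNFL : NoFreeLunch P 𝓕 Pi) :
    ∃ Q : Measure Ω, IsProbabilityMeasure Q ∧ Q ≪ P ∧ P ≪ Q ∧
      ∀ X ∈ costless Pi (StopTime.zero 𝓕) (StopTime.infty 𝓕), ∫ ω, X ω ∂Q ≤ 0 := by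
  have hm := mem_LInfty_infty h𝓕
  have h0 := (StopTime.zero 𝓕).le_infty
  suffices h : Convex ℝ (superCone P 𝓕 Pi) ∧
      (∀ c : ℝ, 0 ≤ c → ∀ X ∈ superCone P 𝓕 Pi, c • X ∈ superCone P 𝓕 Pi) ∧
      ∀ X ≤ 0, X ∈ superCone P 𝓕 Pi by
    obtain ⟨Q, h1, h2, h3, h4⟩ :=
      exists_equivalent_measure_of_closure_inter h.1 h.2.1 h.2.2 hNFL
    exact ⟨Q, h1, h2, h3, fun X hX => h4 X ⟨1, zero_le_one, X, hX.1, hX.2.le, by simp⟩⟩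
  refine ⟨?_, ?_, ?_⟩
  · rintro _ ⟨a, ha, X, hX, hX0, rfl⟩ _ ⟨b, hb, Y, hY, hY0, rfl⟩ s t hs ht hst
    rcases (add_nonneg (mul_nonneg hs ha) (mul_nonneg ht hb)).eq_or_lt with h | h
    · have h5 : s * a = 0 := by nlinarith [mul_nonneg hs ha, mul_nonneg ht hb]
      have h6 : t * b = 0 := by nlinarith [mul_nonneg hs ha, mul_nonneg ht hb]
      refine ⟨0, le_rfl, 0, zero_mem _, (hPi.pricing.normalized _ _ h0).le, ?_⟩
      rw [smul_smul, smul_smul, h5, h6]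
      simp
    · set c := s * a + t * b with hc
      refine ⟨c, h.le, (s * a / c) • X + (1 - s * a / c) • Y, hm _, ?_, ?_⟩
      · have h1 : 0 ≤ s * a / c := div_nonneg (mul_nonneg hs ha) h.le
        have h2 : s * a / c ≤ 1 := (div_le_one h).2 (by linarith [mul_nonneg ht hb])
        refine (hPi.pricing.convex _ _ h0 X hX Y hY _ h1 h2).trans ?_
        have h3 := linfty_smul_le_smul h1 hX0
        have h4 := linfty_smul_le_smul (sub_nonneg.2 h2) hY0
        rw [smul_zero] at h3 h4
        exact add_nonpos h3 h4
      · rw [smul_add, smul_smul, smul_smul, smul_smul, smul_smul, mul_div_cancel₀ _ h.ne',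
          mul_sub, mul_div_cancel₀ _ h.ne', mul_one, hc, add_sub_cancel_left]
  · rintro c hc _ ⟨a, ha, X, hX, hX0, rfl⟩
    exact ⟨c * a, mul_nonneg hc ha, X, hX, hX0, (smul_smul _ _ _)⟩
  · intro X hX
    refine ⟨1, zero_le_one, X, hm X, ?_, by simp⟩
    rw [← hPi.pricing.normalized _ _ h0]
    exact hPi.pricing.monotone _ _ h0 X (hm X) 0 (zero_mem _) hX

end IsTCPP

end Dynamics

/-! ### Penalties and approximating measures -/

section Penalties

variable {Ω : Type*} {m : MeasurableSpace Ω} {P : Measure Ω} {𝓕 : Filtration ℝ≥0 m}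
  {Pi : PricingMaps P 𝓕} {σ τ : StopTime 𝓕}

theorem integral_eq_of_mem_LInfty {Q μ : Measure Ω} (hQ : Q ≪ P) (hμ : μ ≪ P)
    (h : ∀ A, MeasurableSet[σ.2.measurableSpace] A → Q A = μ A) {X : Lp ℝ ∞ P}
    (hX : X ∈ LInfty P σ) : ∫ ω, X ω ∂Q = ∫ ω, X ω ∂μ := by
  obtain ⟨g, hg, hXg⟩ := mem_LInfty_iff.1 hX
  rw [integral_congr_ae (hQ.ae_le hXg), integral_congr_ae (hμ.ae_le hXg),
    integral_trim σ.2.measurableSpace_le hg, integral_trim σ.2.measurableSpace_le hg,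
    trim_eq_of_forall_eq σ.2.measurableSpace_le h]

theorem condExp_sub_price (hPi : IsDynamicPricingProcedure P 𝓕 Pi) (h : σ ≤ τ)
    {Q : Measure Ω} [IsProbabilityMeasure Q] (hQ : Q ≪ P) {X : Lp ℝ ∞ P} (hX : X ∈ LInfty P τ) :
    Q[((X - Pi σ τ X : Lp ℝ ∞ P) : Ω → ℝ) | σ.2.measurableSpace] =ᵐ[Q]
      fun ω => Q[(X : Ω → ℝ) | σ.2.measurableSpace] ω - Pi σ τ X ω := by
  have h1 : ((X - Pi σ τ X : Lp ℝ ∞ P) : Ω → ℝ) =ᵐ[Q] (X : Ω → ℝ) - (Pi σ τ X : Ω → ℝ) :=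
    hQ.ae_le (Lp.coeFn_sub _ _)
  have h2 := condExp_sub (integrable_linfty hQ X) (integrable_linfty hQ (Pi σ τ X))
    σ.2.measurableSpace
  have h3 := condExp_of_aestronglyMeasurable' σ.2.measurableSpace_le
    ((mem_LInfty_iff.1 (hPi.mapsTo σ τ h X hX)).mono_ac hQ) (integrable_linfty hQ (Pi σ τ X))
  filter_upwards [condExp_congr_ae (m := σ.2.measurableSpace) h1, h2, h3] with ω h1 h2 h3
  rw [h1, h2, _root_.Pi.sub_apply, h3]

theorem le_minPenalty {Q : ProbabilityMeasure Ω} {X : Lp ℝ ∞ P} (hX : X ∈ LInfty P τ) :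
    ∀ᵐ ω ∂(Q : Measure Ω),
      (((Q : Measure Ω)[(X : Ω → ℝ) | σ.2.measurableSpace] ω - Pi σ τ X ω : ℝ) : EReal) ≤
        minPenalty Pi Q σ τ ω :=
  (exists_isEssSupOf (Q : Measure Ω) _).choose_spec.le _ ⟨X, hX, rfl⟩

theorem minPenalty_le (hPi : IsDynamicPricingProcedure P 𝓕 Pi) (h : σ ≤ τ)
    {Q : ProbabilityMeasure Ω} (hQ : (Q : Measure Ω) ≪ P) {Z : Ω → EReal} (hZ : Measurable Z)
    (hle : ∀ W ∈ costless Pi σ τ, ∀ᵐ ω ∂(Q : Measure Ω),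
      (((Q : Measure Ω)[(W : Ω → ℝ) | σ.2.measurableSpace] ω : ℝ) : EReal) ≤ Z ω) :
    ∀ᵐ ω ∂(Q : Measure Ω), minPenalty Pi Q σ τ ω ≤ Z ω := by
  refine (exists_isEssSupOf (Q : Measure Ω) _).choose_spec.least Z hZ ?_
  rintro _ ⟨X, hX, rfl⟩
  filter_upwards [hle _ (hPi.sub_mem_costless h hX), condExp_sub_price hPi h hQ hX] with ω h1 h2
  rwa [h2] at h1

/-- If the expectations of the costless positions are almost maximal at `w`, then the minimal
penalty is close to the conditional expectation of `w`. -/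
theorem exists_minPenalty_majorant [IsProbabilityMeasure P]
    (hPi : IsDynamicPricingProcedure P 𝓕 Pi) (h : σ ≤ τ) {Q : ProbabilityMeasure Ω}
    (hQ : (Q : Measure Ω) ≪ P) {w : Lp ℝ ∞ P} (hw : w ∈ costless Pi σ τ) {ε : ℝ}
    (hε : ∀ W ∈ costless Pi σ τ, ∫ ω, W ω ∂(Q : Measure Ω) ≤ ∫ ω, w ω ∂(Q : Measure Ω) + ε) :
    ∃ G : Ω → ℝ≥0∞, Measurable[σ.2.measurableSpace] G ∧
      ∫⁻ ω, G ω ∂(Q : Measure Ω) ≤ ENNReal.ofReal ε ∧ ∀ᵐ ω ∂(Q : Measure Ω),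
        minPenalty Pi Q σ τ ω ≤
          (((Q : Measure Ω)[(w : Ω → ℝ) | σ.2.measurableSpace] ω : ℝ) : EReal) + G ω := by
  have hm := σ.2.measurableSpace_le
  let E : Lp ℝ ∞ P → Ω → ℝ := fun W => (Q : Measure Ω)[(W : Ω → ℝ) | σ.2.measurableSpace]
  have hint : ∀ W : Lp ℝ ∞ P, Integrable W (Q : Measure Ω) := fun W => integrable_linfty hQ W
  have hEint : ∀ W, ∫ ω, E W ω ∂(Q : Measure Ω) = ∫ ω, W ω ∂(Q : Measure Ω) := fun W =>
    integral_condExp hm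
  obtain ⟨G, hG, hGε, hGle⟩ := exists_majorant_of_directed (Q := (Q : Measure Ω)) hm
    (𝒲 := E '' costless Pi σ τ) (w := E w) (ε := ε)
    (by rintro _ ⟨W, -, rfl⟩; exact integrable_condExp)
    (by rintro _ ⟨W, -, rfl⟩; exact stronglyMeasurable_condExp)
    (by
      rintro _ ⟨W₁, h₁, rfl⟩ _ ⟨W₂, h₂, rfl⟩
      -- Gluing on this event realizes the maximum of the two conditional expectations by a costless
      -- position, so the family is directed.
      let A : Set Ω := {ω | E W₂ ω ≤ E W₁ ω}
      have hA : MeasurableSet[σ.2.measurableSpace] A :=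
        measurableSet_le stronglyMeasurable_condExp.measurable
          stronglyMeasurable_condExp.measurable
      obtain ⟨W, hW, hWA⟩ := hPi.exists_glued_costless h h₁ h₂ hA
      have hEW : ∀ᵐ ω ∂(Q : Measure Ω), E W ω = A.indicator (E W₁) ω + Aᶜ.indicator (E W₂) ω := by
        have e1 := condExp_congr_ae (m := σ.2.measurableSpace) (hQ.ae_le hWA)
        have e2 := condExp_add ((hint W₁).indicator (hm A hA))
          ((hint W₂).indicator (hm Aᶜ hA.compl)) σ.2.measurableSpace
        filter_upwards [e1, e2, condExp_indicator (hint W₁) hA,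
          condExp_indicator (hint W₂) hA.compl] with ω e1 e2 e3 e4
        change (Q : Measure Ω)[(W : Ω → ℝ) | σ.2.measurableSpace] ω = _
        rw [e1, e2, _root_.Pi.add_apply, e3, e4]
      refine ⟨E W, ⟨W, hW, rfl⟩, ?_, ?_⟩
      · filter_upwards [hEW] with ω h1
        rw [h1]
        by_cases hω : ω ∈ A
        · simp [hω]
        · have : E W₁ ω ≤ E W₂ ω := (not_le.1 hω).le
          simpa [hω]
      · filter_upwards [hEW] with ω h1
        rw [h1]
        by_cases hω : ω ∈ A
        · have : E W₂ ω ≤ E W₁ ω := hω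
          simpa [hω]
        · simp [hω])
    ⟨w, hw, rfl⟩
    (by
      rintro _ ⟨W, hW, rfl⟩
      rw [hEint, hEint]
      exact hε W hW)
  refine ⟨G, hG, hGε, minPenalty_le hPi h hQ ?_ fun W hW => ?_⟩
  · exact (stronglyMeasurable_condExp.mono hm).measurable.coe_real_ereal.add
      (hG.mono hm le_rfl).coe_ereal_ennreal
  · filter_upwards [hGle _ ⟨W, hW, rfl⟩] with ω h1
    have h2 : ((E W ω - E w ω : ℝ) : EReal) ≤ (G ω : EReal) := by
      refine le_trans ?_ (EReal.coe_ennreal_le_coe_ennreal_iff.2 h1)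
      rw [EReal.coe_ennreal_ofReal]
      exact EReal.coe_le_coe_iff.2 (le_max_left _ _)
    calc ((E W ω : ℝ) : EReal) = ((E w ω : ℝ) : EReal) + ((E W ω - E w ω : ℝ) : EReal) := by
          rw [← EReal.coe_add]; congr 1; ring
      _ ≤ _ := add_le_add le_rfl h2

theorem eq_of_forall_smul_le {a b K : ℝ} (h : ∀ t : ℝ, t * (a - b) ≤ K) : a = b := by
  by_contra hab
  have hne : a - b ≠ 0 := sub_ne_zero.2 hab
  have h1 := h ((K + 1) / (a - b))
  rw [div_mul_cancel₀ _ hne] at h1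
  linarith

/-- Approximately optimal equivalent measures with a prescribed restriction to `ℱ_σ`. -/
theorem IsTCPP.exists_approximating_measure [IsProbabilityMeasure P] (h𝓕 : IsPricingBasis P 𝓕)
    (hPi : IsTCPP P 𝓕 Pi) {Q₀ μ : Measure Ω} [IsProbabilityMeasure Q₀] [IsProbabilityMeasure μ]
    (h₀P : Q₀ ≪ P) (hP₀ : P ≪ Q₀) (hμP : μ ≪ P) (hPμ : P ≪ μ)
    (hQ₀ : ∀ X ∈ costless Pi (StopTime.zero 𝓕) (StopTime.infty 𝓕), ∫ ω, X ω ∂Q₀ ≤ 0)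
    (σ : StopTime 𝓕) (X : Lp ℝ ∞ P) {ε : ℝ} (hε : 0 < ε) :
    ∃ Q : ProbabilityMeasure Ω, IsEquivTo P Q ∧
      (∀ A, MeasurableSet[σ.2.measurableSpace] A → (Q : Measure Ω) A = μ A) ∧
      ∀ Y : Lp ℝ ∞ P, ∫ ω, Y ω ∂(Q : Measure Ω) - ∫ ω, Pi σ (StopTime.infty 𝓕) Y ω ∂μ ≤
        ∫ ω, X ω ∂(Q : Measure Ω) - ∫ ω, Pi σ (StopTime.infty 𝓕) X ω ∂μ + ε := by
  have hm := σ.2.measurableSpace_le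
  have hσ := σ.le_infty
  let r : Lp ℝ ∞ P → ℝ := fun Y => ∫ ω, Pi σ (StopTime.infty 𝓕) Y ω ∂μ
  have hr : ∀ Y, ∫ ω, Pi σ (StopTime.infty 𝓕) Y ω ∂μ = r Y := fun Y => rfl
  have hcash : IsCashFunctional P r := hPi.isCashFunctional h𝓕 σ hμP
  -- Pasting keeps the conditional law of `Q₀` given `ℱ_σ`, so costless positions from `σ` on still
  -- have nonpositive expectation, and agreement with `μ` on `ℱ_σ` then gives `hdom`.
  obtain ⟨Q₁, hQ₁, h₁₀, h₀₁, hagree, hpaste⟩ := exists_pasted_measure (P := P) (Q := Q₀) (R := μ)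
    hm h₀P (hμP.trans hP₀) (h₀P.trans hPμ)
  have h₁P := h₁₀.trans h₀P
  have hdom : ∀ Y : Lp ℝ ∞ P, ∫ ω, Y ω ∂Q₁ ≤ r Y := by
    intro Y
    have hV := hPi.pricing.sub_mem_costless hσ (mem_LInfty_infty h𝓕 Y)
    have h1 := hpaste (Y - Pi σ (StopTime.infty 𝓕) Y) fun A hA => by
      obtain ⟨W, hW, hWA⟩ := hPi.pricing.exists_indicator_costless hσ hV hA
      have h2 := hQ₀ W (hPi.costless_subset σ.zero_le hσ hW)
      rwa [integral_congr_ae (h₀P.ae_le hWA), integral_indicator (hm A hA)] at h2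
    rw [integral_linfty_sub h₁P, integral_eq_of_mem_LInfty h₁P hμP hagree
      (hPi.pricing.mapsTo σ _ hσ Y (mem_LInfty_infty h𝓕 Y))] at h1
    linarith [hr Y]
  obtain ⟨Q₂, hQ₂, h₂P, hdual⟩ := hcash.exists_dual_measure X
    (show r X - ε / 2 < r X by linarith)
  let e₁ : ℝ := ∫ ω, X ω ∂Q₁
  let e₂ : ℝ := ∫ ω, X ω ∂Q₂
  -- The weight of `Q₁` must be positive for equivalence, yet cost at most the half of `ε` left over
  -- by `Q₂`.
  obtain ⟨t, ht0, ht1, ht⟩ : ∃ t : ℝ, 0 < t ∧ t ≤ 1 ∧ t * (r X - ε / 2 - e₁) ≤ ε / 2 := by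
    have hden : 0 < ε / 2 + |r X - ε / 2 - e₁| := by positivity
    refine ⟨ε / 2 / (ε / 2 + |r X - ε / 2 - e₁|), by positivity,
      (div_le_one hden).2 (le_add_of_nonneg_right (abs_nonneg _)), ?_⟩
    rw [div_mul_eq_mul_div, div_le_iff₀ hden]
    have : r X - ε / 2 - e₁ ≤ ε / 2 + |r X - ε / 2 - e₁| :=
      (le_abs_self _).trans (le_add_of_nonneg_left (by positivity))
    gcongr
  let Q : Measure Ω := ENNReal.ofReal (1 - t) • Q₂ + ENNReal.ofReal t • Q₁
  have hQprob : IsProbabilityMeasure Q := by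
    refine ⟨?_⟩
    simp only [Q, Measure.add_apply, Measure.smul_apply, measure_univ, smul_eq_mul, mul_one]
    rw [← ENNReal.ofReal_add (by linarith) ht0.le, sub_add_cancel, ENNReal.ofReal_one]
  have hQP : Q ≪ P := Measure.AbsolutelyContinuous.add_left (h₂P.smul_left _) (h₁P.smul_left _)
  have hPQ : P ≪ Q := by
    refine (hP₀.trans h₀₁).trans ?_
    refine Measure.AbsolutelyContinuous.mk fun A _ hA => ?_
    simp only [Q, Measure.add_apply, Measure.smul_apply, smul_eq_mul, add_eq_zero,
      mul_eq_zero, ENNReal.ofReal_eq_zero] at hA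
    exact hA.2.resolve_left (not_le.2 ht0)
  have hQint : ∀ Y : Lp ℝ ∞ P, ∫ ω, Y ω ∂Q = (1 - t) * ∫ ω, Y ω ∂Q₂ + t * ∫ ω, Y ω ∂Q₁ := by
    intro Y
    rw [integral_add_measure ((integrable_linfty h₂P Y).smul_measure ENNReal.ofReal_ne_top)
      ((integrable_linfty h₁P Y).smul_measure ENNReal.ofReal_ne_top), integral_smul_measure,
      integral_smul_measure, ENNReal.toReal_ofReal (by linarith), ENNReal.toReal_ofReal ht0.le,
      smul_eq_mul, smul_eq_mul]
  have hbound : ∀ Y : Lp ℝ ∞ P, ∫ ω, Y ω ∂Q - r Y ≤ ∫ ω, X ω ∂Q - r X + ε := by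
    intro Y
    rw [hQint, hQint]
    have h1 := mul_le_mul_of_nonneg_left (hdual Y) (sub_nonneg.2 ht1)
    have h2 := mul_le_mul_of_nonneg_left (hdom Y) ht0.le
    change _ ≤ (1 - t) * e₂ + t * e₁ - r X + ε
    change _ ≤ (1 - t) * (e₂ + r Y) at h1
    linarith
  refine ⟨⟨Q, hQprob⟩, ⟨hQP, hPQ⟩, fun A hA => ?_, hbound⟩
  change Q A = μ A
  let I : Lp ℝ ∞ P := indicatorConstLp ∞ (hm A hA) (measure_ne_top P A) (1 : ℝ)
  have hI : I =ᵐ[P] A.indicator fun _ => 1 := indicatorConstLp_top_ae _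
  have hIm : ∀ s : ℝ, s • I ∈ LInfty P σ := fun s =>
    Submodule.smul_mem _ _ (indicatorConstLp_mem_LInfty hA 1)
  have hIint : ∀ ν : Measure Ω, ν ≪ P → ∫ ω, I ω ∂ν = ν.real A := fun ν hν => by
    rw [integral_congr_ae (hν.ae_le hI), integral_indicator_const _ (hm A hA), smul_eq_mul, mul_one]
  -- Multiples of `1_A` are their own price at `σ`, so the bound on all of them, of either sign,
  -- forces agreement on `ℱ_σ`.
  have h1 : Q.real A = μ.real A := eq_of_forall_smul_le
    (K := ∫ ω, X ω ∂Q - r X + ε) fun s => by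
      have h2 := hbound (s • I)
      rw [← hr (s • I), hPi.pricing.price_eq_self hσ (hIm s), integral_linfty_smul hQP,
        integral_linfty_smul hμP, hIint Q hQP, hIint μ hμP] at h2
      linarith
  rwa [measureReal_def, measureReal_def, ENNReal.toReal_eq_toReal_iff' (measure_ne_top _ _)
    (measure_ne_top _ _)] at h1

end Penalties

/-! ### Dual representations by local martingale measures -/

section Representation

variable {Ω : Type*} {m : MeasurableSpace Ω} {P : Measure Ω} {𝓕 : Filtration ℝ≥0 m}
  {Pi : PricingMaps P 𝓕} {σ τ : StopTime 𝓕}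

theorem ae_iInf_eq_zero_of_lintegral_le {μ : Measure Ω} {G : ℕ → Ω → ℝ≥0∞}
    (hG : ∀ n, Measurable (G n))
    (h : ∀ n : ℕ, ∫⁻ ω, G n ω ∂μ ≤ ENNReal.ofReal (1 / ((n : ℝ) + 1))) :
    ∀ᵐ ω ∂μ, ⨅ n, G n ω = 0 := by
  have hzero : ∫⁻ ω, ⨅ n, G n ω ∂μ = 0 := by
    refine le_antisymm (ge_of_tendsto' (f := fun n : ℕ => ENNReal.ofReal (1 / ((n : ℝ) + 1)))
      (x := atTop) ?_ fun n => ?_) zero_le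
    · have h1 := ENNReal.tendsto_ofReal (tendsto_one_div_add_atTop_nhds_zero_nat (𝕜 := ℝ))
      rwa [ENNReal.ofReal_zero] at h1
    · exact (lintegral_mono fun ω => iInf_le _ n).trans (h n)
  exact (lintegral_eq_zero_iff (Measurable.iInf hG)).1 hzero

theorem coe_le_of_forall_sub_le {p : ℝ} {z : EReal} {g : ℕ → ℝ≥0∞} (hg : ⨅ n, g n = 0)
    (h : ∀ n, (p : EReal) - (g n : EReal) ≤ z) : (p : EReal) ≤ z := by
  by_contra! hlt
  obtain ⟨r, hzr, hrp⟩ := EReal.lt_iff_exists_real_btwn.1 hlt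
  have hrp' : r < p := EReal.coe_lt_coe_iff.1 hrp
  obtain ⟨n, hn⟩ := iInf_lt_iff.1 (show ⨅ n, g n < ENNReal.ofReal (p - r) by
    rw [hg, ENNReal.ofReal_pos]; linarith)
  have h1 : (g n : EReal) ≤ ((p - r : ℝ) : EReal) := by
    refine (EReal.coe_ennreal_le_coe_ennreal_iff.2 hn.le).trans ?_
    rw [EReal.coe_ennreal_ofReal, max_eq_left (by linarith)]
  have h2 : (r : EReal) ≤ (p : EReal) - (g n : EReal) := by
    have h3 : (r : EReal) = (p : EReal) - ((p - r : ℝ) : EReal) := by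
      rw [← EReal.coe_sub]; congr 1; ring
    rw [h3]
    exact EReal.sub_le_sub le_rfl h1
  exact absurd (hzr.trans_le (h2.trans (h n))) (lt_irrefl _)

theorem sub_minPenalty_le_price [IsProbabilityMeasure P] {Q : ProbabilityMeasure Ω}
    (hQ : IsEquivTo P Q) {X : Lp ℝ ∞ P} (hX : X ∈ LInfty P τ) :
    ∀ᵐ ω ∂P, (((Q : Measure Ω)[(X : Ω → ℝ) | σ.2.measurableSpace] ω : ℝ) : EReal)
        - minPenalty Pi Q σ τ ω ≤ ((Pi σ τ X ω : ℝ) : EReal) := by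
  filter_upwards [hQ.2.ae_le (le_minPenalty (Pi := Pi) (σ := σ) (Q := Q) hX)] with ω h
  rw [EReal.coe_sub] at h
  rw [EReal.sub_le_iff_le_add (Or.inr (EReal.coe_ne_top _)) (Or.inr (EReal.coe_ne_bot _))]
  rw [EReal.sub_le_iff_le_add (Or.inl (EReal.coe_ne_bot _)) (Or.inl (EReal.coe_ne_top _))] at h
  rwa [add_comm]

/-- A set of equivalent measures that contains approximately optimal ones represents the
procedure. -/
theorem IsTCPP.isRepresentedAt [IsProbabilityMeasure P] (hPi : IsTCPP P 𝓕 Pi) (h : σ ≤ τ)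
    {μ : Measure Ω} (hμP : μ ≪ P) (hPμ : P ≪ μ)
    {𝒬 : Set (ProbabilityMeasure Ω)} (h𝒬 : ∀ Q ∈ 𝒬, IsEquivTo P Q)
    (happ : ∀ X : Lp ℝ ∞ P, ∀ ε > 0, ∃ Q ∈ 𝒬,
      (∀ A, MeasurableSet[σ.2.measurableSpace] A → (Q : Measure Ω) A = μ A) ∧
      ∀ Y : Lp ℝ ∞ P, ∫ ω, Y ω ∂(Q : Measure Ω) - ∫ ω, Pi σ (StopTime.infty 𝓕) Y ω ∂μ ≤
        ∫ ω, X ω ∂(Q : Measure Ω) - ∫ ω, Pi σ (StopTime.infty 𝓕) X ω ∂μ + ε) :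
    IsRepresentedAt P 𝓕 Pi σ τ 𝒬 := by
  intro X hX
  have hm := σ.2.measurableSpace_le
  have hZ := (exists_isEssSupOf P {f | ∃ Q ∈ 𝒬, f = fun ω =>
      (((Q : Measure Ω)[(X : Ω → ℝ) | σ.2.measurableSpace] ω : ℝ) : EReal)
        - minPenalty Pi Q σ τ ω}).choose_spec
  change _ =ᵐ[P] (exists_isEssSupOf P {f | ∃ Q ∈ 𝒬, f = fun ω =>
      (((Q : Measure Ω)[(X : Ω → ℝ) | σ.2.measurableSpace] ω : ℝ) : EReal)
        - minPenalty Pi Q σ τ ω}).choose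
  set Z := (exists_isEssSupOf P {f | ∃ Q ∈ 𝒬, f = fun ω =>
      (((Q : Measure Ω)[(X : Ω → ℝ) | σ.2.measurableSpace] ω : ℝ) : EReal)
        - minPenalty Pi Q σ τ ω}).choose with hZdef
  have hupper : Z ≤ᵐ[P] fun ω => ((Pi σ τ X ω : ℝ) : EReal) := by
    refine hZ.least _ (Lp.stronglyMeasurable _).measurable.coe_real_ereal ?_
    rintro _ ⟨Q, hQ, rfl⟩
    exact sub_minPenalty_le_price (h𝒬 Q hQ) hX
  have hstep : ∀ n : ℕ, ∃ G : Ω → ℝ≥0∞, Measurable[σ.2.measurableSpace] G ∧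
      ∫⁻ ω, G ω ∂μ ≤ ENNReal.ofReal (1 / ((n : ℝ) + 1)) ∧
      ∀ᵐ ω ∂P, ((Pi σ τ X ω : ℝ) : EReal) - (G ω : EReal) ≤ Z ω := by
    intro n
    -- Near-optimality at `X` says that `X - Π_{σ,τ}(X)` almost maximizes the `Q`-expectation among
    -- costless positions, so the penalty exceeds its conditional expectation by at most `G`.
    -- Agreement on `ℱ_σ` transfers the smallness of `G` to the fixed measure `μ`.
    obtain ⟨Q, hQ, hagree, hopt⟩ := happ X (1 / ((n : ℝ) + 1)) (by positivity)
    have hQP := (h𝒬 Q hQ).1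
    have hw := hPi.pricing.sub_mem_costless h hX
    obtain ⟨G, hG, hGε, hGle⟩ := exists_minPenalty_majorant hPi.pricing h hQP hw
      (ε := 1 / ((n : ℝ) + 1)) (fun W hW => by
        have h1 := hopt W
        rw [hPi.price_infty_eq h hW.1, hPi.price_infty_eq h hX, hW.2,
          integral_congr_ae (hμP.ae_le (Lp.coeFn_zero ℝ ∞ P)),
          ← integral_eq_of_mem_LInfty hQP hμP hagree (hPi.pricing.mapsTo σ τ h X hX)] at h1
        rw [integral_linfty_sub hQP]
        simpa using h1)
    refine ⟨G, hG, ?_, ?_⟩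
    · rwa [← lintegral_trim hm hG, ← trim_eq_of_forall_eq hm hagree, lintegral_trim hm hG]
    · filter_upwards [hZ.le _ ⟨Q, hQ, rfl⟩, (h𝒬 Q hQ).2.ae_le hGle,
        (h𝒬 Q hQ).2.ae_le (condExp_sub_price hPi.pricing h hQP hX)] with ω h1 h2 h3
      refine le_trans ?_ h1
      rw [h3] at h2
      refine le_trans ?_ (EReal.sub_le_sub le_rfl h2)
      generalize (Q : Measure Ω)[(X : Ω → ℝ) | σ.2.measurableSpace] ω = a
      generalize Pi σ τ X ω = p
      generalize G ω = g
      induction g with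
      | top => simp
      | coe g =>
        rw [show ((g : ℝ≥0∞) : EReal) = ((g : ℝ) : EReal) from rfl]
        norm_cast
        linarith
  choose G hG hGε hGZ using hstep
  have hinf := hPμ.ae_le (ae_iInf_eq_zero_of_lintegral_le (fun n => (hG n).mono hm le_rfl) hGε)
  filter_upwards [hupper, hinf, ae_all_iff.2 hGZ] with ω h1 h2 h3
  exact le_antisymm (coe_le_of_forall_sub_le h2 h3) h1

variable {d : ℕ} {S : Fin (d + 1) → ℝ≥0 → Ω → ℝ}

/-- If the expectations of the costless positions are bounded, then a procedure that extends the
dynamics of `S` forces `Q` to be a local martingale measure. -/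
theorem IsTCPP.isLocalMartingaleMeasureBetween [IsProbabilityMeasure P] (hPi : IsTCPP P 𝓕 Pi)
    (hext : ExtendsDynamics P 𝓕 Pi S) {ν : StopTime 𝓕} {Q : ProbabilityMeasure Ω}
    (hQ : (Q : Measure Ω) ≪ P) {K : ℝ}
    (hK : ∀ W ∈ costless Pi ν (StopTime.infty 𝓕), ∫ ω, W ω ∂(Q : Measure Ω) ≤ K) :
    IsLocalMartingaleMeasureBetween P 𝓕 S ν (StopTime.infty 𝓕) Q := by
  intro k σ τ hνσ hστ _ X hX hXS Y hY
  have hm := σ.2.measurableSpace_le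
  have hn : ∀ n : ℤ, Pi σ τ ((n : ℝ) • X) =ᵐ[P] fun ω => (n : ℝ) * Y ω := fun n =>
    hext k n σ τ hστ X hX hXS Y hY
  let y : Lp ℝ ∞ P := Pi σ τ X
  have hyσ : y ∈ LInfty P σ := hPi.pricing.mapsTo σ τ hστ X hX
  have hyY : y =ᵐ[P] Y := by
    have h1 := hn 1
    simp only [Int.cast_one, one_smul, one_mul] at h1
    exact h1
  have hny : ∀ n : ℤ, (n : ℝ) • (X - y) ∈ costless Pi σ τ := by
    intro n
    have h1 := hPi.pricing.sub_mem_costless hστ (Submodule.smul_mem _ (n : ℝ) hX)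
    have h2 : Pi σ τ ((n : ℝ) • X) = (n : ℝ) • y := by
      apply Lp.ext
      filter_upwards [hn n, hyY, Lp.coeFn_smul (n : ℝ) y] with ω e1 e2 e3
      rw [e1, e3, _root_.Pi.smul_apply, e2, smul_eq_mul]
    rwa [h2, ← smul_sub] at h1
  have hXi := integrable_linfty hQ X
  have hyi := integrable_linfty hQ y
  have key : (y : Ω → ℝ) =ᵐ[(Q : Measure Ω)]
      (Q : Measure Ω)[(X : Ω → ℝ) | σ.2.measurableSpace] := by
    refine ae_eq_condExp_of_forall_setIntegral_eq hm hXi (fun _ _ _ => hyi.integrableOn)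
      (fun A hA _ => ?_) ((mem_LInfty_iff.1 hyσ).mono_ac hQ)
    -- Restricting the costless `n • (X - y)` to `A` keeps it costless; a bound uniform over
    -- integers of both signs leaves only a zero difference.
    have hbound : ∀ n : ℤ, (n : ℝ) * (∫ ω in A, X ω ∂(Q : Measure Ω) -
        ∫ ω in A, y ω ∂(Q : Measure Ω)) ≤ K := by
      intro n
      obtain ⟨W, hW, hWA⟩ := hPi.pricing.exists_indicator_costless hστ (hny n) hA
      have h1 := hK W (hPi.costless_subset hνσ hστ hW)
      rw [integral_congr_ae (hQ.ae_le hWA), integral_indicator (hm A hA)] at h1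
      rw [← integral_sub hXi.integrableOn hyi.integrableOn, ← integral_const_mul]
      refine le_of_eq_of_le (integral_congr_ae (ae_restrict_of_ae (hQ.ae_le ?_))) h1
      filter_upwards [Lp.coeFn_smul (n : ℝ) (X - y), Lp.coeFn_sub X y] with ω e1 e2
      rw [e1, _root_.Pi.smul_apply, e2, _root_.Pi.sub_apply, smul_eq_mul]
    by_contra hne
    have hne' : (∫ ω in A, X ω ∂(Q : Measure Ω) - ∫ ω in A, y ω ∂(Q : Measure Ω)) ≠ 0 :=
      sub_ne_zero.2 (Ne.symm hne)
    set D := ∫ ω in A, X ω ∂(Q : Measure Ω) - ∫ ω in A, y ω ∂(Q : Measure Ω)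
    rcases lt_or_gt_of_ne hne' with h | h
    · obtain ⟨N, hN⟩ := exists_int_lt (K / D)
      have h1 := hbound N
      rw [lt_div_iff_of_neg h] at hN
      linarith
    · obtain ⟨N, hN⟩ := exists_int_gt (K / D)
      have h1 := hbound N
      rw [div_lt_iff₀ h] at hN
      linarith
  exact key.symm.trans (hQ.ae_le hyY)

/-- A procedure represented by equivalent local martingale measures extends the dynamics. -/
theorem extendsDynamics_of_isRepresentedAt [IsProbabilityMeasure P]
    (hPi : IsDynamicPricingProcedure P 𝓕 Pi)
    (hrep : ∀ σ τ : StopTime 𝓕, σ ≤ τ → ∃ 𝒬 : Set (ProbabilityMeasure Ω),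
      (∀ Q ∈ 𝒬, IsEquivTo P Q ∧ IsLocalMartingaleMeasureBetween P 𝓕 S σ τ Q) ∧
      IsRepresentedAt P 𝓕 Pi σ τ 𝒬) : ExtendsDynamics P 𝓕 Pi S := by
  intro k n σ τ h X hX hXS Y hY
  have hm := σ.2.measurableSpace_le
  obtain ⟨𝒬, h𝒬, hR⟩ := hrep σ τ h
  have hR0 := hR 0 (zero_mem _)
  have hRn := hR ((n : ℝ) • X) (Submodule.smul_mem _ _ hX)
  rw [hPi.normalized σ τ h] at hR0
  unfold essSupOf at hR0 hRn
  have hZ0 := (exists_isEssSupOf P {f | ∃ Q ∈ 𝒬, f = fun ω =>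
      (((Q : Measure Ω)[((0 : Lp ℝ ∞ P) : Ω → ℝ) | σ.2.measurableSpace] ω : ℝ) : EReal)
        - minPenalty Pi Q σ τ ω}).choose_spec
  have hZn := (exists_isEssSupOf P {f | ∃ Q ∈ 𝒬, f = fun ω =>
      (((Q : Measure Ω)[(((n : ℝ) • X : Lp ℝ ∞ P) : Ω → ℝ) | σ.2.measurableSpace] ω : ℝ) : EReal)
        - minPenalty Pi Q σ τ ω}).choose_spec
  have hzero := Lp.coeFn_zero ℝ ∞ P
  have hE0 : ∀ Q ∈ 𝒬,
      (Q : Measure Ω)[((0 : Lp ℝ ∞ P) : Ω → ℝ) | σ.2.measurableSpace] =ᵐ[P] 0 := by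
    intro Q hQ
    have h1 := condExp_congr_ae (m := σ.2.measurableSpace) ((h𝒬 Q hQ).1.1.ae_le hzero)
    rw [condExp_zero] at h1
    exact (h𝒬 Q hQ).1.2.ae_le h1
  have hE1 : ∀ Q ∈ 𝒬, (Q : Measure Ω)[(X : Ω → ℝ) | σ.2.measurableSpace] =ᵐ[P] Y := fun Q hQ =>
    (h𝒬 Q hQ).1.2.ae_le ((h𝒬 Q hQ).2 k σ τ le_rfl h le_rfl X hX hXS Y hY)
  have hEn : ∀ Q ∈ 𝒬, (Q : Measure Ω)[(((n : ℝ) • X : Lp ℝ ∞ P) : Ω → ℝ) | σ.2.measurableSpace]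
      =ᵐ[P] fun ω => (n : ℝ) * Y ω := by
    intro Q hQ
    have h1 := condExp_congr_ae (m := σ.2.measurableSpace)
      ((h𝒬 Q hQ).1.1.ae_le (Lp.coeFn_smul (n : ℝ) X))
    have h2 := condExp_smul (μ := (Q : Measure Ω)) (n : ℝ) (X : Ω → ℝ) σ.2.measurableSpace
    filter_upwards [hE1 Q hQ, (h𝒬 Q hQ).1.2.ae_le h1, (h𝒬 Q hQ).1.2.ae_le h2] with ω e1 e2 e3
    rw [e2, e3, _root_.Pi.smul_apply, e1, smul_eq_mul]
  -- The essential supremum of an empty family is `⊥`, which cannot represent `Π_{σ,τ}(0) = 0`.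
  obtain ⟨Q₀, hQ₀⟩ : 𝒬.Nonempty := by
    by_contra! hemp
    have h1 := hZ0.least (fun _ => ⊥) measurable_const (by
      rintro _ ⟨Q, hQ, -⟩
      rw [hemp] at hQ
      exact absurd hQ (Set.notMem_empty _))
    obtain ⟨ω, h2, h3⟩ := (h1.and hR0).exists
    rw [← h3] at h2
    exact absurd h2 (not_le.2 (EReal.bot_lt_coe _))
  -- A measurable version of `Y`, as required of the comparison functions for an essential supremum.
  let y : Ω → ℝ := (Q₀ : Measure Ω)[(X : Ω → ℝ) | σ.2.measurableSpace]
  have hy : Measurable y := (stronglyMeasurable_condExp.mono hm).measurable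
  have hyY : y =ᵐ[P] Y := hE1 Q₀ hQ₀
  have hupper := hZn.least (fun ω => (((n : ℝ) * y ω : ℝ) : EReal))
    (hy.const_mul _).coe_real_ereal (by
      rintro _ ⟨Q, hQ, rfl⟩
      filter_upwards [hEn Q hQ, hE0 Q hQ, hZ0.le _ ⟨Q, hQ, rfl⟩, hR0, hzero, hyY]
        with ω e1 e2 e3 e4 e5 e6
      rw [← e4, e2, e5, _root_.Pi.zero_apply] at e3
      rw [e1, e6]
      have e7 : 0 ≤ minPenalty Pi Q σ τ ω := by
        rwa [EReal.coe_zero, zero_sub, EReal.neg_le, neg_zero] at e3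
      simpa using EReal.sub_le_sub (le_refl (((n : ℝ) * Y ω : ℝ) : EReal)) e7)
  -- The representation at `n • X` bounds every `-α` by `Π(n • X) - n * y`; the one at `0` says that
  -- the essential supremum of the `-α` is `0`.
  have hlower := hZ0.least
    (fun ω => ((Pi σ τ ((n : ℝ) • X) ω - (n : ℝ) * y ω : ℝ) : EReal))
    ((Lp.stronglyMeasurable _).measurable.sub (hy.const_mul _)).coe_real_ereal (by
      rintro _ ⟨Q, hQ, rfl⟩
      filter_upwards [hEn Q hQ, hE0 Q hQ, hZn.le _ ⟨Q, hQ, rfl⟩, hRn, hyY]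
        with ω e1 e2 e3 e4 e6
      rw [← e4, e1] at e3
      rw [e2, e6, _root_.Pi.zero_apply]
      generalize minPenalty Pi Q σ τ ω = a at e3
      generalize Pi σ τ ((n : ℝ) • X) ω = p at e3
      generalize (n : ℝ) * Y ω = b at e3
      induction a with
      | bot => simp at e3
      | top => simp
      | coe a =>
        norm_cast at e3 ⊢
        linarith)
  filter_upwards [hupper, hlower, hR0, hRn, hzero, hyY] with ω e1 e2 e3 e4 e5 e6
  rw [← e4, EReal.coe_le_coe_iff, e6] at e1
  rw [← e3, e5, _root_.Pi.zero_apply, EReal.coe_le_coe_iff, e6] at e2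
  exact le_antisymm e1 (by linarith)

end Representation

/-! ### Finite penalties and the two families of representing measures -/

section Conclusion

variable {Ω : Type*} {m : MeasurableSpace Ω} {P : Measure Ω} {𝓕 : Filtration ℝ≥0 m}
  {Pi : PricingMaps P 𝓕} {σ τ : StopTime 𝓕}

/-- Bounded expectations of the costless positions bound the mean of the minimal penalty. -/
theorem exists_minPenalty_bound [IsProbabilityMeasure P]
    (hPi : IsDynamicPricingProcedure P 𝓕 Pi) (h : σ ≤ τ) {Q : ProbabilityMeasure Ω}
    (hQ : (Q : Measure Ω) ≪ P) {K : ℝ}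
    (hK : ∀ W ∈ costless Pi σ τ, ∫ ω, W ω ∂(Q : Measure Ω) ≤ K) :
    ∃ G : Ω → ℝ≥0∞, Measurable G ∧ ∫⁻ ω, G ω ∂(Q : Measure Ω) < ∞ ∧
      ∀ᵐ ω ∂(Q : Measure Ω), minPenalty Pi Q σ τ ω ≤ (G ω : EReal) := by
  have h0 : ((0 : Lp ℝ ∞ P) : Ω → ℝ) =ᵐ[(Q : Measure Ω)] 0 := hQ.ae_le (Lp.coeFn_zero ℝ ∞ P)
  obtain ⟨G, hG, hGK, hGle⟩ := exists_minPenalty_majorant hPi h hQ (hPi.zero_mem_costless h)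
    (ε := K) (fun W hW => by
      rw [integral_congr_ae h0]
      simpa using hK W hW)
  refine ⟨G, hG.mono σ.2.measurableSpace_le le_rfl, hGK.trans_lt ENNReal.ofReal_lt_top, ?_⟩
  have h1 := condExp_congr_ae (m := σ.2.measurableSpace) h0
  rw [condExp_zero] at h1
  filter_upwards [hGle, h1] with ω h2 h3
  rwa [h3, _root_.Pi.zero_apply, EReal.coe_zero, zero_add] at h2

variable {d : ℕ} {S : Fin (d + 1) → ℝ≥0 → Ω → ℝ}

/-- The approximating measures are made to agree with `Q₀`, not `P`, on `ℱ_σ`: this controls trades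
before `σ` as well, so the penalty is finite already from time `0`. -/
theorem IsTCPP.isRepresentedAt_equivLocalMartingaleMeasures [IsProbabilityMeasure P]
    (h𝓕 : IsPricingBasis P 𝓕) (hPi : IsTCPP P 𝓕 Pi) (hNFL : NoFreeLunch P 𝓕 Pi)
    (hext : ExtendsDynamics P 𝓕 Pi S) (h : σ ≤ τ) :
    IsRepresentedAt P 𝓕 Pi σ τ {Q ∈ equivLocalMartingaleMeasures P 𝓕 S |
      ∀ᵐ ω ∂(Q : Measure Ω),
        minPenalty Pi Q (StopTime.zero 𝓕) (StopTime.infty 𝓕) ω < ⊤} := by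
  obtain ⟨Q₀, hprob, h₀P, hP₀, hQ₀⟩ := hPi.exists_equivalent_measure h𝓕 hNFL
  refine hPi.isRepresentedAt h h₀P hP₀ (fun Q hQ => hQ.1.1) fun X ε hε => ?_
  obtain ⟨Q, hQ, hagree, hopt⟩ :=
    hPi.exists_approximating_measure h𝓕 h₀P hP₀ h₀P hP₀ hQ₀ σ X hε
  refine ⟨Q, ?_, hagree, hopt⟩
  let K : ℝ := ∫ ω, X ω ∂(Q : Measure Ω) - ∫ ω, Pi σ (StopTime.infty 𝓕) X ω ∂Q₀ + ε
  have hK : ∀ W ∈ costless Pi (StopTime.zero 𝓕) (StopTime.infty 𝓕),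
      ∫ ω, W ω ∂(Q : Measure Ω) ≤ K := by
    intro W hW
    -- The value of `W` at `σ` is itself costless from `0` to `σ`, so its `Q₀`-expectation is
    -- nonpositive; near-optimality bounds what `W` gains beyond it.
    have hVσ := hPi.pricing.mapsTo σ _ σ.le_infty W hW.1
    have hV : Pi σ (StopTime.infty 𝓕) W ∈ costless Pi (StopTime.zero 𝓕) σ := by
      refine ⟨hVσ, ?_⟩
      rw [hPi.timeConsistent _ σ _ σ.zero_le σ.le_infty W hW.1, hW.2]
    have h1 := hQ₀ _ (hPi.costless_subset le_rfl σ.zero_le hV)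
    have h2 := hopt W
    change _ ≤ K at h2
    linarith
  obtain ⟨G, hG, hGfin, hGle⟩ :=
    exists_minPenalty_bound hPi.pricing (StopTime.zero 𝓕).le_infty hQ.1 hK
  refine ⟨⟨hQ, hPi.isLocalMartingaleMeasureBetween hext hQ.1 hK⟩, ?_⟩
  filter_upwards [hGle, ae_lt_top hG hGfin.ne] with ω h1 h2
  exact h1.trans_lt (lt_top_iff_ne_top.2 (EReal.coe_ennreal_eq_top_iff.not.2 h2.ne))

/-- Only trades after `σ` matter here, so the approximating measures can agree with `P` on `ℱ_σ`;
costless positions from `σ` have price `0`, and near-optimality bounds them directly. -/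
theorem IsTCPP.isRepresentedAt_condEquivMeasures [IsProbabilityMeasure P]
    (h𝓕 : IsPricingBasis P 𝓕) (hPi : IsTCPP P 𝓕 Pi) (hNFL : NoFreeLunch P 𝓕 Pi)
    (hext : ExtendsDynamics P 𝓕 Pi S) (h : σ ≤ τ) :
    IsRepresentedAt P 𝓕 Pi σ τ {Q ∈ condEquivMeasures P 𝓕 Pi σ τ |
      IsLocalMartingaleMeasureBetween P 𝓕 S σ τ Q} := by
  obtain ⟨Q₀, hprob, h₀P, hP₀, hQ₀⟩ := hPi.exists_equivalent_measure h𝓕 hNFL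
  have hPP : P ≪ P := Measure.AbsolutelyContinuous.rfl
  refine hPi.isRepresentedAt h hPP hPP (fun Q hQ => hQ.1.1) fun X ε hε => ?_
  obtain ⟨Q, hQ, hagree, hopt⟩ :=
    hPi.exists_approximating_measure h𝓕 h₀P hP₀ hPP hPP hQ₀ σ X hε
  refine ⟨Q, ?_, hagree, hopt⟩
  let K : ℝ := ∫ ω, X ω ∂(Q : Measure Ω) - ∫ ω, Pi σ (StopTime.infty 𝓕) X ω ∂P + ε
  have hK : ∀ W ∈ costless Pi σ (StopTime.infty 𝓕), ∫ ω, W ω ∂(Q : Measure Ω) ≤ K := by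
    intro W hW
    have h2 := hopt W
    rw [hW.2, integral_congr_ae (Lp.coeFn_zero ℝ ∞ P)] at h2
    simpa using h2
  obtain ⟨G, hG, hGfin, hGle⟩ := exists_minPenalty_bound hPi.pricing h hQ.1
    fun W hW => hK W (hPi.costless_subset le_rfl h hW)
  refine ⟨⟨hQ, hagree, (lintegral_mono_ae ?_).trans_lt hGfin⟩,
    fun k σ' τ' h1 h2 _ => hPi.isLocalMartingaleMeasureBetween hext hQ.1 hK k σ' τ' h1 h2
      τ'.le_infty⟩
  filter_upwards [hGle] with ω h1
  exact (EReal.toENNReal_le_toENNReal h1).trans_eq EReal.toENNReal_coe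

end Conclusion

theorem mainTheorem9 {Ω : Type*} {m : MeasurableSpace Ω} (P : Measure Ω) [IsProbabilityMeasure P]
    (𝓕 : Filtration ℝ≥0 m) (h𝓕 : IsPricingBasis P 𝓕)
    {d : ℕ} (S : Fin (d + 1) → ℝ≥0 → Ω → ℝ) (hS : IsMarket P 𝓕 S)
    (Pi : PricingMaps P 𝓕) (hPi : IsTCPP P 𝓕 Pi) (hNFL : NoFreeLunch P 𝓕 Pi) :
    (ExtendsDynamics P 𝓕 Pi S ↔
      ∃ 𝒬 : Set (ProbabilityMeasure Ω), 𝒬 ⊆ equivLocalMartingaleMeasures P 𝓕 S ∧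
        ∀ σ τ : StopTime 𝓕, σ ≤ τ → IsRepresentedAt P 𝓕 Pi σ τ 𝒬) ∧
    (ExtendsDynamics P 𝓕 Pi S ↔
      ∀ σ τ : StopTime 𝓕, σ ≤ τ → IsRepresentedAt P 𝓕 Pi σ τ
        {Q ∈ equivLocalMartingaleMeasures P 𝓕 S |
          ∀ᵐ ω ∂(Q : Measure Ω),
            minPenalty Pi Q (StopTime.zero 𝓕) (StopTime.infty 𝓕) ω < ⊤}) ∧
    (ExtendsDynamics P 𝓕 Pi S ↔
      ∀ σ τ : StopTime 𝓕, σ ≤ τ → IsRepresentedAt P 𝓕 Pi σ τ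
        {Q ∈ condEquivMeasures P 𝓕 Pi σ τ |
          IsLocalMartingaleMeasureBetween P 𝓕 S σ τ Q}) := by
  have hrestrict : ∀ Q ∈ equivLocalMartingaleMeasures P 𝓕 S, ∀ σ τ : StopTime 𝓕,
      IsEquivTo P Q ∧ IsLocalMartingaleMeasureBetween P 𝓕 S σ τ Q := fun Q hQ σ τ =>
    ⟨hQ.1, fun k σ' τ' _ h _ => hQ.2 k σ' τ' σ'.zero_le h τ'.le_infty⟩
  refine ⟨⟨fun hext => ⟨_, Set.sep_subset _ _, fun σ τ h =>
      hPi.isRepresentedAt_equivLocalMartingaleMeasures h𝓕 hNFL hext h⟩, ?_⟩,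
    ⟨fun hext σ τ h => hPi.isRepresentedAt_equivLocalMartingaleMeasures h𝓕 hNFL hext h, ?_⟩,
    ⟨fun hext σ τ h => hPi.isRepresentedAt_condEquivMeasures h𝓕 hNFL hext h, ?_⟩⟩
  · rintro ⟨𝒬, h𝒬, hrep⟩
    exact extendsDynamics_of_isRepresentedAt hPi.pricing fun σ τ h =>
      ⟨𝒬, fun Q hQ => hrestrict Q (h𝒬 hQ) σ τ, hrep σ τ h⟩
  · intro hrep
    exact extendsDynamics_of_isRepresentedAt hPi.pricing fun σ τ h =>
      ⟨_, fun Q hQ => hrestrict Q hQ.1 σ τ, hrep σ τ h⟩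
  · intro hrep
    exact extendsDynamics_of_isRepresentedAt hPi.pricing fun σ τ h =>
      ⟨_, fun Q hQ => ⟨hQ.1.1, hQ.2⟩, hrep σ τ h⟩
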